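/- **Theorem 4.1 with Corollaries 4.1–4.3.** Let $A,B,C$ be real matrices of sizes $n\times n$, $n\times r$, $l\times n$ with $n\ge 1$, and consider the system $\dot x=Ax+Bu$, $y=Cx$ with transfer function matrix $G(s)=C(sI_n-A)^{-1}B$. Suppose that the system is completely controllable (for all $t_0<t_1$ any state at time $t_0$ can be transferred by a suitable input to any state at time $t_1$) and completely observable (on any interval $[t_0,t_1]$ with $0\le t_0<t_1$ the input and the output determine the state). Let $\nu$ be the controllability index of $(A,B)$, i.e. the smallest integer with $\operatorname{rank}[B,AB,\dots,A^{n-1}B]=\operatorname{rank}[B,AB,\dots,A^{\nu-1}B]$, and suppose that $n=r\nu$. Put $N_\nu=[O,\dots,O,I_r]\,[B,AB,\dots,A^{\nu-1}B]^{-1}$, let $N$ be the $n\times n$ matrix with block rows $N_\nu,N_\nu A,\dots,N_\nu A^{\nu-1}$, and let $A^*=NAN^{-1}$, $B^*=NB$, $C^*=CN^{-1}=[C_1,\dots,C_\nu]$ with $l\times r$ blocks $C_i$. Write the last $r$ rows of $A^*$ as $[-A^*_{21},-A^*_{22},\dots,-A^*_{2\nu}]$ with $r\times r$ blocks, and let $$C(s)=C_1+C_2s+\cdots+C_\nu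 s^{\nu-1},\qquad A_2^*(s)=A^*_{21}+A^*_{22}s+\cdots+A^*_{2\nu}s^{\nu-1}+I_rs^\nu .$$ Then: 1. $N$ is nonsingular, $A^*$ is block companion (identity blocks $I_r$ on the block superdiagonal, last block row $[-A^*_{21},\dots,-A^*_{2\nu}]$, zeros elsewhere) and $B^*=\begin{bmatrix}O\\ I_r\end{bmatrix}$ (Asseo's form); moreover $\det A_2^*(s)\not\equiv 0$ and $G(s)=C(s)A_2^*(s)^{-1}$. 2. $C(s)$ and $A_2^*(s)$ are relatively right prime, i.e. they have a greatest common right divisor (over real polynomial matrices) that is unimodular. 3. Consequently $C(s)$ is a numerator of $G(s)$, i.e. $G(s)=C(s)P(s)^{-1}$ for some nonsingular $r\times r$ polynomial matrix $P(s)$ such that $C(s)$ and $P(s)$ are relatively right prime. 4. The transmission zeros of the system coincide, with multiplicities, with the complex zeros of the invariant polynomials of $C(s)$, taken all together. 5. If $r=l$ and $G(s)$ has full normal rank $r$, then $\det C(s)\not\equiv 0$ and the transmission zeros coincide, with multiplicities, with the complex zeros of $\det C(s)$. Here the invariant polynomials of a polynomial matrix of normal rank $m$ are $\epsilon_i=d_i/d_{i-1}$,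 $i=1,\dots,m$, where $d_0=1$ and $d_i$ is the monic greatest common divisor of its minors of order $i$. The transmission zeros are the complex zeros, taken all together with multiplicities, of the polynomials $\epsilon_i$ in the Smith–McMillan form $\operatorname{diag}(\epsilon_1/\psi_1,\dots,\epsilon_m/\psi_m)$ (bordered by zeros) of $G(s)$, where $m$ is the normal rank of $G(s)$ and $\epsilon_i/\psi_i$ is the reduced form of $\sigma_i/\varphi$, with $\varphi$ the monic least common denominator of the entries of $G$ and $\sigma_1,\dots,\sigma_m$ the invariant polynomials of $\varphi G$. -/

import Mathlib

open Polynomial Matrix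

noncomputable section

namespace Asseo

/-! ### The linear system `x' = A x + B u`, `y = C x` -/

/-- `x` is a state trajectory of `x' = A x + B u` on the time interval `[t₀, t₁]`, generated by
the continuous input `u`. -/
def IsTrajectory {n r : ℕ} (A : Matrix (Fin n) (Fin n) ℝ) (B : Matrix (Fin n) (Fin r) ℝ)
    (t₀ t₁ : ℝ) (u : ℝ → Fin r → ℝ) (x : ℝ → Fin n → ℝ) : Prop :=
  ContinuousOn u (Set.Icc t₀ t₁) ∧
    ∀ t ∈ Set.Icc t₀ t₁, HasDerivWithinAt x (A *ᵥ x t + B *ᵥ u t) (Set.Icc t₀ t₁) t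

/-- Complete controllability: any initial state at any time `t₀` can be transferred by some input
to any final state at any finite time `t₁ > t₀`. -/
def Controllable {n r : ℕ} (A : Matrix (Fin n) (Fin n) ℝ) (B : Matrix (Fin n) (Fin r) ℝ) : Prop :=
  ∀ t₀ t₁ : ℝ, t₀ < t₁ → ∀ x₀ x₁ : Fin n → ℝ,
    ∃ (u : ℝ → Fin r → ℝ) (x : ℝ → Fin n → ℝ),
      IsTrajectory A B t₀ t₁ u x ∧ x t₀ = x₀ ∧ x t₁ = x₁

/-- Complete observability: over any finite interval `[t₀, t₁]` with `t₁ > t₀ ≥ 0` the state is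
determined by the input and the output on that interval. -/
def Observable {n r l : ℕ} (A : Matrix (Fin n) (Fin n) ℝ) (B : Matrix (Fin n) (Fin r) ℝ)
    (C : Matrix (Fin l) (Fin n) ℝ) : Prop :=
  ∀ t₀ t₁ : ℝ, 0 ≤ t₀ → t₀ < t₁ →
    ∀ (u : ℝ → Fin r → ℝ) (x x' : ℝ → Fin n → ℝ),
      IsTrajectory A B t₀ t₁ u x → IsTrajectory A B t₀ t₁ u x' →
      (∀ t ∈ Set.Icc t₀ t₁, C *ᵥ x t = C *ᵥ x' t) →
      ∀ t ∈ Set.Icc t₀ t₁, x t = x' t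

/-- The block matrix `[B, AB, …, A^{k-1} B]`; column `(j, c)` is column `c` of `A ^ j * B`. -/
def ctrbMatrix {n r : ℕ} (A : Matrix (Fin n) (Fin n) ℝ) (B : Matrix (Fin n) (Fin r) ℝ) (k : ℕ) :
    Matrix (Fin n) (Fin k × Fin r) ℝ :=
  Matrix.of fun i jc => (A ^ (jc.1 : ℕ) * B) i jc.2

/-- `ν` is the controllability index of `(A, B)`: the smallest integer with
`rank [B, AB, …, A^{n-1} B] = rank [B, AB, …, A^{ν-1} B]`. -/
def IsControllabilityIndex {n r : ℕ} (A : Matrix (Fin n) (Fin n) ℝ) (B : Matrix (Fin n) (Fin r) ℝ)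
    (ν : ℕ) : Prop :=
  IsLeast {k : ℕ | (ctrbMatrix A B n).rank = (ctrbMatrix A B k).rank} ν

/-- The transfer function matrix `G(s) = C (s I - A)⁻¹ B`, over the field of rational functions. -/
def transferMatrix {n r l : ℕ} (A : Matrix (Fin n) (Fin n) ℝ) (B : Matrix (Fin n) (Fin r) ℝ)
    (C : Matrix (Fin l) (Fin n) ℝ) : Matrix (Fin l) (Fin r) (RatFunc ℝ) :=
  C.map RatFunc.C * ((RatFunc.X : RatFunc ℝ) • (1 : Matrix (Fin n) (Fin n) (RatFunc ℝ)) -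
    A.map RatFunc.C)⁻¹ * B.map RatFunc.C

/-! ### The controllable block companion form (Asseo's form), for `n = ν r` -/

/-- Splitting of the `n = ν r` coordinates into `ν` consecutive blocks of length `r`:
`(i, a)` is coordinate `i r + a`. -/
def blockEquiv {n ν r : ℕ} (hn : n = ν * r) : Fin ν × Fin r ≃ Fin n :=
  finProdFinEquiv.trans (finCongr hn.symm)

/-- The `r × n` block matrix `[O, …, O, I_r]`. -/
def lastBlock {n ν r : ℕ} (hn : n = ν * r) : Matrix (Fin r) (Fin n) ℝ :=
  Matrix.of fun a k =>
    if (((blockEquiv hn).symm k).1 : ℕ) + 1 = ν ∧ ((blockEquiv hn).symm k).2 = a then 1 else 0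

/-- `N_ν = [O, …, O, I_r] [B, AB, …, A^{ν-1} B]⁻¹`, the top block of the transformation. -/
def topBlock {n ν r : ℕ} (hn : n = ν * r) (A : Matrix (Fin n) (Fin n) ℝ)
    (B : Matrix (Fin n) (Fin r) ℝ) : Matrix (Fin r) (Fin n) ℝ :=
  lastBlock hn * ((ctrbMatrix A B ν).submatrix id (blockEquiv hn).symm)⁻¹

/-- The transformation matrix `N`, with block rows `N_ν, N_ν A, …, N_ν A^{ν-1}`. -/
def transformation {n ν r : ℕ} (hn : n = ν * r) (A : Matrix (Fin n) (Fin n) ℝ)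
    (B : Matrix (Fin n) (Fin r) ℝ) : Matrix (Fin n) (Fin n) ℝ :=
  Matrix.of fun k j =>
    (topBlock hn A B * A ^ (((blockEquiv hn).symm k).1 : ℕ)) ((blockEquiv hn).symm k).2 j

/-- `A* = N A N⁻¹`. -/
def AStar {n ν r : ℕ} (hn : n = ν * r) (A : Matrix (Fin n) (Fin n) ℝ)
    (B : Matrix (Fin n) (Fin r) ℝ) : Matrix (Fin n) (Fin n) ℝ :=
  transformation hn A B * A * (transformation hn A B)⁻¹

/-- `B* = N B`. -/
def BStar {n ν r : ℕ} (hn : n = ν * r) (A : Matrix (Fin n) (Fin n) ℝ)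
    (B : Matrix (Fin n) (Fin r) ℝ) : Matrix (Fin n) (Fin r) ℝ :=
  transformation hn A B * B

/-- `C* = C N⁻¹`. -/
def CStar {n ν r l : ℕ} (hn : n = ν * r) (A : Matrix (Fin n) (Fin n) ℝ)
    (B : Matrix (Fin n) (Fin r) ℝ) (C : Matrix (Fin l) (Fin n) ℝ) : Matrix (Fin l) (Fin n) ℝ :=
  C * (transformation hn A B)⁻¹

/-- The `i`-th block of `r` columns of a matrix with `n = ν r` columns. -/
def colBlock {n ν r m : ℕ} (hn : n = ν * r) (M : Matrix (Fin m) (Fin n) ℝ) (i : Fin ν) :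
    Matrix (Fin m) (Fin r) ℝ :=
  M.submatrix id fun b => blockEquiv hn (i, b)

/-- The `r × r` block `A*_{2,i+1}`: the last block row of `A*` is
`[-A*_{21}, -A*_{22}, …, -A*_{2ν}]`. -/
def AStarTwo {n ν r : ℕ} (hn : n = ν * r) (A : Matrix (Fin n) (Fin n) ℝ)
    (B : Matrix (Fin n) (Fin r) ℝ) (i : Fin ν) : Matrix (Fin r) (Fin r) ℝ :=
  -colBlock hn (lastBlock hn * AStar hn A B) i

/-- The block companion matrix of `I s^ν + T_{ν-1} s^{ν-1} + … + T_0`: identity blocks on the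
block superdiagonal, last block row `[-T_0, …, -T_{ν-1}]`, zero elsewhere. -/
def blockCompanion {n ν r : ℕ} (hn : n = ν * r) (T : Fin ν → Matrix (Fin r) (Fin r) ℝ) :
    Matrix (Fin n) (Fin n) ℝ :=
  (Matrix.of fun (p q : Fin ν × Fin r) =>
    if (p.1 : ℕ) + 1 = ν then -(T q.1 p.2 q.2)
    else if (q.1 : ℕ) = (p.1 : ℕ) + 1 ∧ q.2 = p.2 then 1 else 0).submatrix
      (blockEquiv hn).symm (blockEquiv hn).symm

/-- `C(s) = C_1 + C_2 s + … + C_ν s^{ν-1}`, where `C* = [C_1, …, C_ν]`. -/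
def numPoly {n ν r l : ℕ} (hn : n = ν * r) (A : Matrix (Fin n) (Fin n) ℝ)
    (B : Matrix (Fin n) (Fin r) ℝ) (C : Matrix (Fin l) (Fin n) ℝ) :
    Matrix (Fin l) (Fin r) ℝ[X] :=
  ∑ i : Fin ν, (X : ℝ[X]) ^ (i : ℕ) • (colBlock hn (CStar hn A B C) i).map Polynomial.C

/-- `A₂*(s) = A*_{21} + A*_{22} s + … + A*_{2ν} s^{ν-1} + I_r s^ν`. -/
def denPoly {n ν r : ℕ} (hn : n = ν * r) (A : Matrix (Fin n) (Fin n) ℝ)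
    (B : Matrix (Fin n) (Fin r) ℝ) : Matrix (Fin r) (Fin r) ℝ[X] :=
  ∑ i : Fin ν, (X : ℝ[X]) ^ (i : ℕ) • (AStarTwo hn A B i).map Polynomial.C +
    (X : ℝ[X]) ^ ν • (1 : Matrix (Fin r) (Fin r) ℝ[X])

/-! ### Polynomial matrices: relative primeness and numerators -/

/-- A polynomial matrix, viewed as a matrix of rational functions. -/
def toRat {l r : ℕ} (P : Matrix (Fin l) (Fin r) ℝ[X]) : Matrix (Fin l) (Fin r) (RatFunc ℝ) :=
  P.map (algebraMap ℝ[X] (RatFunc ℝ))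

/-- `D` is a common right divisor of `K` and `P`. -/
def IsCommonRightDivisor {l r : ℕ} (D : Matrix (Fin r) (Fin r) ℝ[X])
    (K : Matrix (Fin l) (Fin r) ℝ[X]) (P : Matrix (Fin r) (Fin r) ℝ[X]) : Prop :=
  (∃ K₁ : Matrix (Fin l) (Fin r) ℝ[X], K = K₁ * D) ∧
    ∃ P₁ : Matrix (Fin r) (Fin r) ℝ[X], P = P₁ * D

/-- `D` is a greatest common right divisor of `K` and `P`: a common right divisor that is a left
multiple of every common right divisor. -/
def IsGreatestCommonRightDivisor {l r : ℕ} (D : Matrix (Fin r) (Fin r) ℝ[X])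
    (K : Matrix (Fin l) (Fin r) ℝ[X]) (P : Matrix (Fin r) (Fin r) ℝ[X]) : Prop :=
  IsCommonRightDivisor D K P ∧
    ∀ D' : Matrix (Fin r) (Fin r) ℝ[X], IsCommonRightDivisor D' K P →
      ∃ Q : Matrix (Fin r) (Fin r) ℝ[X], D = Q * D'

/-- A square polynomial matrix is unimodular if its determinant is a nonzero constant. -/
def IsUnimodular {r : ℕ} (U : Matrix (Fin r) (Fin r) ℝ[X]) : Prop :=
  ∃ c : ℝ, c ≠ 0 ∧ U.det = Polynomial.C c

/-- `K` and `P` are relatively right prime: they have a unimodular greatest common right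
divisor. -/
def RelativelyRightPrime {l r : ℕ} (K : Matrix (Fin l) (Fin r) ℝ[X])
    (P : Matrix (Fin r) (Fin r) ℝ[X]) : Prop :=
  ∃ D : Matrix (Fin r) (Fin r) ℝ[X], IsGreatestCommonRightDivisor D K P ∧ IsUnimodular D

/-- `K` is a numerator of the rational matrix `G`: `G = K P⁻¹` with `K` and `P` relatively right
prime. -/
def IsNumerator {l r : ℕ} (G : Matrix (Fin l) (Fin r) (RatFunc ℝ))
    (K : Matrix (Fin l) (Fin r) ℝ[X]) : Prop :=
  ∃ P : Matrix (Fin r) (Fin r) ℝ[X],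
    P.det ≠ 0 ∧ G = toRat K * (toRat P)⁻¹ ∧ RelativelyRightPrime K P

/-! ### Invariant polynomials, Smith-McMillan form, transmission zeros -/

/-- The monic greatest common divisor `d_j` of all minors of order `j` of `P`, as the monic
generator of the ideal they span. Index maps with repetitions only contribute the value `0`, and
reordered ones only a sign. -/
def detDivisor {l r : ℕ} (P : Matrix (Fin l) (Fin r) ℝ[X]) (j : ℕ) : ℝ[X] :=
  normalize (Submodule.IsPrincipal.generator
    (Ideal.span (Set.range fun fg : (Fin j → Fin l) × (Fin j → Fin r) =>
      (P.submatrix fg.1 fg.2).det)))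

/-- The normal rank of a polynomial matrix. -/
def normalRank {l r : ℕ} (P : Matrix (Fin l) (Fin r) ℝ[X]) : ℕ := (toRat P).rank

/-- The invariant polynomial `ε_{i+1} = d_{i+1} / d_i` of `P` (for `i` below the normal rank). -/
def invariantPoly {l r : ℕ} (P : Matrix (Fin l) (Fin r) ℝ[X]) (i : ℕ) : ℝ[X] :=
  detDivisor P (i + 1) / detDivisor P i

/-- The complex zeros of all invariant polynomials of `P`, taken all together, i.e. with
multiplicities. -/
def invariantZeros {l r : ℕ} (P : Matrix (Fin l) (Fin r) ℝ[X]) : Multiset ℂ :=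
  ∑ i ∈ Finset.range (normalRank P), (invariantPoly P i).aroots ℂ

/-- The monic least common denominator of all entries of `W`, as the monic generator of the
intersection of the ideals generated by the denominators. -/
def leastCommonDenom {l r : ℕ} (W : Matrix (Fin l) (Fin r) (RatFunc ℝ)) : ℝ[X] :=
  normalize (Submodule.IsPrincipal.generator
    (⨅ ij : Fin l × Fin r, Ideal.span {(W ij.1 ij.2).denom}))

/-- The polynomial matrix `T(s) = φ(s) W(s)`, with `φ` the least common denominator of `W`. -/
def clearDenom {l r : ℕ} (W : Matrix (Fin l) (Fin r) (RatFunc ℝ)) : Matrix (Fin l) (Fin r) ℝ[X] :=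
  Matrix.of fun i j => (W i j).num * (leastCommonDenom W / (W i j).denom)

/-- The `(i+1)`-th diagonal entry of the Smith-McMillan form of `W`: the `(i+1)`-th invariant
polynomial of `T = φ W`, divided by `φ`. -/
def smithMcMillan {l r : ℕ} (W : Matrix (Fin l) (Fin r) (RatFunc ℝ)) (i : ℕ) : RatFunc ℝ :=
  algebraMap ℝ[X] (RatFunc ℝ) (invariantPoly (clearDenom W) i) /
    algebraMap ℝ[X] (RatFunc ℝ) (leastCommonDenom W)

/-- The transmission zeros: the complex zeros of the reduced numerators `ε_i` of the diagonal
entries `ε_i / ψ_i` of the Smith-McMillan form, taken all together (with multiplicities). -/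
def transmissionZeros {l r : ℕ} (W : Matrix (Fin l) (Fin r) (RatFunc ℝ)) : Multiset ℂ :=
  ∑ i ∈ Finset.range W.rank, (smithMcMillan W i).num.aroots ℂ

end Asseo

end

/-!
The state-space part rests on a polynomial identity. Put `S = [I; sI; …; s^{ν-1} I]`, with `n` rows.
Since `N [B, AB, …]` is block antitriangular with identity blocks on the antidiagonal, `N` is
invertible, and the shift structure of its block rows makes `A* = N A N⁻¹` block companion. Reading
off the rows of the companion matrix gives `(sI - A*) S = B* A₂*(s)`
(`charmatrix_AStar_mul_powerColumn`), hence `(sI - A) (N⁻¹ S) = B A₂*(s)`, while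
`C(s) = C (N⁻¹ S)`. As `sI - A` is nonsingular and `N⁻¹ S` is left invertible, `A₂*(s)` is
nonsingular and `G = C(s) A₂*(s)⁻¹` (`det_ne_zero_of_resolvent`, `transferMatrix_eq_of_resolvent`).

Controllability and observability, which are statements about trajectories, enter through their
algebraic rank criteria. Both follow from one uniqueness argument: if `w` annihilates all `Aᵏ B`,
then the scalars `w Aⁱ x(t)`, `i < n`, solve a homogeneous linear differential equation
(`dotProduct_trajectory_eq_zero`). Observability then says that the rows of all `C Aᵏ` span, and
since `sᵏ I ≡ Aᵏ` modulo `sI - A`, the stacked matrix `[C; sI - A]` has a polynomial left inverse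
(`Observable.exists_bezout`). Multiplying by `N⁻¹ S` turns it into a Bezout identity
`X₁ C(s) + Y₁ A₂*(s) = I`, which is relative right primeness.

For the zeros, let `G = K P⁻¹` be any fraction with a Bezout identity. A Smith form of `φ G`
(`exists_smithForm`) gives the Smith-McMillan form `diag(εᵢ/ψᵢ)` of `G`, and hence a second fraction
with a Bezout identity, whose numerator is equivalent to `diag(εᵢ)`. Two such fractions differ by a
unimodular right factor (`unimodularEquiv_of_bezout`), so `diag(εᵢ)` is a Smith form of `K`
(`exists_smith_transmissionZeros`). Determinantal ideals are invariant under equivalence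
(`UnimodularEquiv.minorIdeal_eq`), so the `εᵢ` are the invariant polynomials of `K` up to units; in
the square case of full rank their product is associated to `det K`.
-/

noncomputable section

namespace Asseo

/-! ### The Smith form over a Euclidean domain -/

/-- The rectangular matrix with the sequence `d` on its main diagonal and zeros elsewhere. -/
def rectDiag {R : Type*} [Zero R] (l r : ℕ) (d : ℕ → R) : Matrix (Fin l) (Fin r) R :=
  Matrix.of fun i j => if (i : ℕ) = j then d i else 0

/-- Unimodular equivalence of matrices over a commutative ring. -/
def UnimodularEquiv {R : Type*} [CommRing R] {l r : ℕ} (M N : Matrix (Fin l) (Fin r) R) : Prop :=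
  ∃ (U : Matrix (Fin l) (Fin l) R) (V : Matrix (Fin r) (Fin r) R),
    IsUnit U.det ∧ IsUnit V.det ∧ U * M * V = N

section CommRing

variable {R : Type*} [CommRing R] {l r : ℕ}

theorem UnimodularEquiv.refl (M : Matrix (Fin l) (Fin r) R) : UnimodularEquiv M M :=
  ⟨1, 1, by simp, by simp, by simp⟩

theorem UnimodularEquiv.trans {M N P : Matrix (Fin l) (Fin r) R}
    (h₁ : UnimodularEquiv M N) (h₂ : UnimodularEquiv N P) : UnimodularEquiv M P := by
  obtain ⟨U, V, hU, hV, rfl⟩ := h₁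
  obtain ⟨U', V', hU', hV', rfl⟩ := h₂
  refine ⟨U' * U, V * V', ?_, ?_, by simp only [Matrix.mul_assoc]⟩
  · rw [det_mul]; exact hU'.mul hU
  · rw [det_mul]; exact hV.mul hV'

theorem UnimodularEquiv.symm {M N : Matrix (Fin l) (Fin r) R}
    (h : UnimodularEquiv M N) : UnimodularEquiv N M := by
  obtain ⟨U, V, hU, hV, rfl⟩ := h
  refine ⟨U⁻¹, V⁻¹, ?_, ?_, ?_⟩
  · exact (isUnit_nonsing_inv_det_iff).2 hU
  · exact (isUnit_nonsing_inv_det_iff).2 hV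
  · rw [← Matrix.mul_assoc, ← Matrix.mul_assoc, nonsing_inv_mul _ hU, Matrix.one_mul,
      Matrix.mul_assoc, mul_nonsing_inv _ hV, Matrix.mul_one]

theorem UnimodularEquiv.mul_left {U : Matrix (Fin l) (Fin l) R} (hU : IsUnit U.det)
    (M : Matrix (Fin l) (Fin r) R) : UnimodularEquiv M (U * M) :=
  ⟨U, 1, hU, by simp, by simp⟩

theorem UnimodularEquiv.mul_right {V : Matrix (Fin r) (Fin r) R} (hV : IsUnit V.det)
    (M : Matrix (Fin l) (Fin r) R) : UnimodularEquiv M (M * V) :=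
  ⟨1, V, by simp, hV, by simp⟩

theorem UnimodularEquiv.transpose {M N : Matrix (Fin l) (Fin r) R}
    (h : UnimodularEquiv M N) : UnimodularEquiv Mᵀ Nᵀ := by
  obtain ⟨U, V, hU, hV, rfl⟩ := h
  exact ⟨Vᵀ, Uᵀ, by rwa [det_transpose], by rwa [det_transpose], by
    simp only [transpose_mul, Matrix.mul_assoc]⟩

/-- Adding `c` times row `i` to row `i'` is a unimodular operation. -/
theorem UnimodularEquiv.addRow (M : Matrix (Fin l) (Fin r) R) {i i' : Fin l} (h : i' ≠ i) (c : R) :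
    UnimodularEquiv M (M.updateRow i' (M i' + c • M i)) := by
  convert UnimodularEquiv.mul_left (U := Matrix.transvection i' i c)
    (by rw [det_transvection_of_ne _ _ h]; exact isUnit_one) M using 1
  ext a b
  by_cases ha : a = i'
  · subst ha; simp [transvection_mul_apply_same]
  · simp [Matrix.transvection_mul_apply_of_ne, ha]

theorem UnimodularEquiv.submatrix (M : Matrix (Fin l) (Fin r) R) (e : Equiv.Perm (Fin l))
    (f : Equiv.Perm (Fin r)) : UnimodularEquiv M (M.submatrix e f) := by
  refine ⟨(1 : Matrix (Fin l) (Fin l) R).submatrix e id,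
    (1 : Matrix (Fin r) (Fin r) R).submatrix id f, ?_, ?_, ?_⟩
  · rw [det_permute, det_one, mul_one]
    exact (Equiv.Perm.sign e).isUnit.map (Int.castRingHom R)
  · rw [det_permute', det_one, mul_one]
    exact (Equiv.Perm.sign f).isUnit.map (Int.castRingHom R)
  · ext a b
    simp [Matrix.mul_apply, Matrix.one_apply]

end CommRing

section Euclidean

variable {R : Type*} [EuclideanDomain R]

theorem dvd_column_of_minimal {l r : ℕ} {M : Matrix (Fin l) (Fin r) R} {i : Fin l} {j : Fin r}
    (hmin : ∀ N, UnimodularEquiv M N → ∀ i' j', N i' j' ≠ 0 →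
      ¬ EuclideanDomain.r (N i' j') (M i j)) (h0 : M i j ≠ 0) (i' : Fin l) :
    M i j ∣ M i' j := by
  classical
  by_cases hi : i' = i
  · rw [hi]
  have hN := UnimodularEquiv.addRow M hi (-(M i' j / M i j))
  have hrem : M i' j + -(M i' j / M i j) * M i j = M i' j % M i j := by
    rw [EuclideanDomain.mod_eq_sub_mul_div]; ring
  by_contra hdvd
  refine hmin _ hN i' j ?_ ?_
  · simp only [updateRow_self, Pi.add_apply, Pi.smul_apply, smul_eq_mul, hrem]
    rwa [Ne, EuclideanDomain.mod_eq_zero]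
  · simp only [updateRow_self, Pi.add_apply, Pi.smul_apply, smul_eq_mul, hrem]
    exact EuclideanDomain.mod_lt _ h0

theorem dvd_row_of_minimal {l r : ℕ} {M : Matrix (Fin l) (Fin r) R} {i : Fin l} {j : Fin r}
    (hmin : ∀ N, UnimodularEquiv M N → ∀ i' j', N i' j' ≠ 0 →
      ¬ EuclideanDomain.r (N i' j') (M i j)) (h0 : M i j ≠ 0) (j' : Fin r) :
    M i j ∣ M i j' := by
  refine dvd_column_of_minimal (M := Mᵀ) (i := j) (j := i) (fun N hN a b hab => ?_) h0 j'
  exact hmin Nᵀ (by simpa using hN.transpose) b a hab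

/-- A nonzero entry that is minimal for the Euclidean order among the nonzero entries of all
equivalent matrices divides every entry. -/
theorem dvd_of_minimal {l r : ℕ} {M : Matrix (Fin l) (Fin r) R} {i : Fin l} {j : Fin r}
    (hmin : ∀ N, UnimodularEquiv M N → ∀ i' j', N i' j' ≠ 0 →
      ¬ EuclideanDomain.r (N i' j') (M i j)) (h0 : M i j ≠ 0) (i' : Fin l) (j' : Fin r) :
    M i j ∣ M i' j' := by
  classical
  by_cases hi : i' = i
  · rw [hi]; exact dvd_row_of_minimal hmin h0 j'
  obtain ⟨q, hq⟩ := dvd_column_of_minimal hmin h0 i'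
  -- Clear column `j` in row `i'`, then add row `i'` to row `i`: the pivot is unchanged, hence still
  -- minimal, and now row `i` also involves the entry `(i', j')`.
  set N := M.updateRow i' (M i' + (-q) • M i) with hN
  have hMN : UnimodularEquiv M N := UnimodularEquiv.addRow M hi _
  have hNi : N i = M i := by rw [hN, updateRow_ne (Ne.symm hi)]
  have hNi' : N i' = M i' + (-q) • M i := by rw [hN, updateRow_self]
  set P := N.updateRow i (N i + (1 : R) • N i') with hP
  have hMP : UnimodularEquiv M P := hMN.trans (UnimodularEquiv.addRow N (Ne.symm hi) _)
  have hPi : P i = M i + (M i' + (-q) • M i) := by rw [hP, updateRow_self, hNi, hNi', one_smul]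
  have hPij : P i j = M i j := by
    simp only [hPi, Pi.add_apply, Pi.smul_apply, smul_eq_mul, hq]; ring
  have h1 : P i j ∣ P i j' := by
    refine dvd_row_of_minimal (fun Q hQ a b hab => ?_) (by rwa [hPij]) j'
    rw [hPij]
    exact hmin Q (hMP.trans hQ) a b hab
  have h2 := dvd_row_of_minimal hmin h0 j'
  rw [hPij, hPi] at h1
  simp only [Pi.add_apply, Pi.smul_apply, smul_eq_mul] at h1
  have h3 : M i' j' = (M i j' + (M i' j' + -q * M i j')) - (1 - q) * M i j' := by ring
  rw [h3]
  exact dvd_sub h1 (h2.mul_left _)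

/-- Every nonzero matrix is equivalent to one whose top left entry divides all entries. -/
theorem exists_equiv_corner_dvd {l r : ℕ} (M : Matrix (Fin (l + 1)) (Fin (r + 1)) R) (hM : M ≠ 0) :
    ∃ N, UnimodularEquiv M N ∧ N 0 0 ≠ 0 ∧ ∀ i j, N 0 0 ∣ N i j := by
  classical
  set S : Set R := {a | a ≠ 0 ∧ ∃ N i j, UnimodularEquiv M N ∧ N i j = a} with hS
  have hne : S.Nonempty := by
    by_contra hemp
    refine hM (Matrix.ext fun i j => ?_)
    by_contra h
    exact hemp ⟨M i j, h, M, i, j, UnimodularEquiv.refl M, rfl⟩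
  obtain ⟨a, ⟨ha, N, i, j, hN, rfl⟩, hmin⟩ :=
    (EuclideanDomain.r_wellFounded (R := R)).has_min S hne
  have hdvd : ∀ i' j', N i j ∣ N i' j' :=
    dvd_of_minimal (fun Q hQ a b hab => hmin _ ⟨hab, Q, a, b, hN.trans hQ, rfl⟩) ha
  refine ⟨N.submatrix (Equiv.swap 0 i) (Equiv.swap 0 j), hN.trans (UnimodularEquiv.submatrix _ _ _),
    ?_, ?_⟩
  · simpa using ha
  · intro i' j'
    simpa using hdvd _ _

/-- The block diagonal matrix with blocks `a` (of size one) and `M`. -/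
def cornerSum {R : Type*} [Zero R] {l r : ℕ} (a : R) (M : Matrix (Fin l) (Fin r) R) :
    Matrix (Fin (l + 1)) (Fin (r + 1)) R :=
  Matrix.of (Fin.cons (Fin.cons a 0) fun i => Fin.cons 0 (M i))

theorem cornerSum_mul {l m r : ℕ} (a b : R) (M : Matrix (Fin l) (Fin m) R)
    (N : Matrix (Fin m) (Fin r) R) :
    cornerSum a M * cornerSum b N = cornerSum (a * b) (M * N) := by
  ext i j
  refine Fin.cases ?_ (fun i => ?_) i <;> refine Fin.cases ?_ (fun j => ?_) j <;>
    simp [cornerSum, Matrix.mul_apply, Fin.sum_univ_succ]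

theorem det_cornerSum {l : ℕ} (a : R) (M : Matrix (Fin l) (Fin l) R) :
    (cornerSum a M).det = a * M.det := by
  rw [det_succ_row_zero, Fin.sum_univ_succ]
  have : (cornerSum a M).submatrix Fin.succ Fin.succ = M := by ext i j; simp [cornerSum]
  simp only [cornerSum] at this ⊢
  simp [this]

theorem UnimodularEquiv.cornerSum {l r : ℕ} (a : R) {M N : Matrix (Fin l) (Fin r) R}
    (h : UnimodularEquiv M N) : UnimodularEquiv (cornerSum a M) (cornerSum a N) := by
  obtain ⟨U, V, hU, hV, rfl⟩ := h
  refine ⟨Asseo.cornerSum 1 U, Asseo.cornerSum 1 V, ?_, ?_, ?_⟩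
  · rwa [det_cornerSum, one_mul]
  · rwa [det_cornerSum, one_mul]
  · simp [cornerSum_mul]

/-- A corner entry dividing its row and its column splits off by unimodular operations. -/
theorem exists_equiv_cornerSum {l r : ℕ} (M : Matrix (Fin (l + 1)) (Fin (r + 1)) R)
    (hdvd : ∀ i j, M 0 0 ∣ M i j) :
    ∃ N : Matrix (Fin l) (Fin r) R, UnimodularEquiv M (cornerSum (M 0 0) N) ∧
      ∀ i j, M 0 0 ∣ N i j := by
  choose q hq using hdvd
  -- `M` is the product of a lower unitriangular factor, the block sum, and an upper
  -- unitriangular factor.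
  let L : Matrix (Fin (l + 1)) (Fin (l + 1)) R :=
    Matrix.of (Fin.cons (Fin.cons 1 0) fun i => Fin.cons (q i.succ 0) ((1 : Matrix _ _ R) i))
  let W : Matrix (Fin (r + 1)) (Fin (r + 1)) R :=
    Matrix.of (Fin.cons (Fin.cons 1 fun j => q 0 j.succ) fun i => Fin.cons 0 ((1 : Matrix _ _ R) i))
  let N : Matrix (Fin l) (Fin r) R :=
    Matrix.of fun i j => M i.succ j.succ - M 0 0 * (q i.succ 0 * q 0 j.succ)
  have hL : L.det = 1 := by
    rw [det_succ_row_zero, Fin.sum_univ_succ]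
    have : L.submatrix Fin.succ Fin.succ = 1 := by ext i j; simp [L]
    simp [L] at this ⊢
    rw [this, det_one]
  have hW : W.det = 1 := by
    rw [det_succ_column_zero, Fin.sum_univ_succ]
    have : W.submatrix Fin.succ Fin.succ = 1 := by ext i j; simp [W]
    simp [W] at this ⊢
    rw [this, det_one]
  refine ⟨N, UnimodularEquiv.symm ⟨L, W, by simp [hL], by simp [hW], ?_⟩, fun i j => ?_⟩
  · ext i j
    refine Fin.cases ?_ (fun i => ?_) i <;> refine Fin.cases ?_ (fun j => ?_) j <;>
      simp [L, W, N, Asseo.cornerSum, Matrix.mul_apply, Fin.sum_univ_succ, Matrix.one_apply]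
    · exact (hq 0 j.succ).symm
    · rw [mul_comm]; exact (hq i.succ 0).symm
    · ring
  · exact dvd_sub (Dvd.intro _ (hq i.succ j.succ).symm) (Dvd.intro _ rfl)

theorem dvd_of_unimodularEquiv {l r : ℕ} {M N : Matrix (Fin l) (Fin r) R}
    (h : UnimodularEquiv M N) {a : R} (ha : ∀ i j, a ∣ M i j) (i : Fin l) (j : Fin r) :
    a ∣ N i j := by
  obtain ⟨U, V, -, -, rfl⟩ := h
  simp only [Matrix.mul_apply]
  exact Finset.dvd_sum fun k _ => Dvd.dvd.mul_right
    (Finset.dvd_sum fun k' _ => (ha _ _).mul_left _) _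

/-- **Smith form**: every matrix over a Euclidean domain is equivalent to a diagonal matrix whose
diagonal entries form a divisibility chain. -/
theorem exists_smithForm {l r : ℕ} (M : Matrix (Fin l) (Fin r) R) :
    ∃ d : ℕ → R, UnimodularEquiv M (rectDiag l r d) ∧ (∀ i, d i ∣ d (i + 1)) ∧
      ∀ i, min l r ≤ i → d i = 0 := by
  induction l generalizing r with
  | zero => exact ⟨0, by convert UnimodularEquiv.refl M; ext i; exact i.elim0, by simp, by simp⟩
  | succ l ih =>
    rcases r with _ | r
    · exact ⟨0, by convert UnimodularEquiv.refl M; ext _ j; exact j.elim0, by simp, by simp⟩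
    by_cases hM : M = 0
    · subst hM
      refine ⟨0, ?_, by simp, by simp⟩
      convert UnimodularEquiv.refl (0 : Matrix (Fin (l + 1)) (Fin (r + 1)) R)
      ext i j; simp [rectDiag]
    obtain ⟨N, hMN, -, hdvd⟩ := exists_equiv_corner_dvd M hM
    obtain ⟨N', hNN', hdvd'⟩ := exists_equiv_cornerSum N hdvd
    obtain ⟨d, hd, hchain, hzero⟩ := ih N'
    refine ⟨fun i => Nat.casesOn i (N 0 0) d, ?_, ?_, ?_⟩
    · refine hMN.trans (hNN'.trans ?_)
      convert UnimodularEquiv.cornerSum (N 0 0) hd using 1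
      ext i j
      refine Fin.cases ?_ (fun i => ?_) i <;> refine Fin.cases ?_ (fun j => ?_) j <;>
        simp [rectDiag, Asseo.cornerSum]
    · rintro (_ | i)
      · change N 0 0 ∣ d 0
        by_cases h : min l r = 0
        · rw [hzero 0 h.le]; exact dvd_zero _
        · have hl : 0 < l := by omega
          have hr : 0 < r := by omega
          simpa [rectDiag] using dvd_of_unimodularEquiv hd hdvd' ⟨0, hl⟩ ⟨0, hr⟩
      · exact hchain i
    · rintro (_ | i) hi
      · simp at hi
      · exact hzero i (by omega)

end Euclidean

/-! ### Determinantal ideals -/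

section Minors

variable {R : Type*} [CommRing R] {l r : ℕ}

/-- The ideal spanned by the minors of order `j` of `M`; as in `detDivisor`, rows and columns are
selected by arbitrary maps. -/
def minorIdeal (M : Matrix (Fin l) (Fin r) R) (j : ℕ) : Ideal R :=
  Ideal.span (Set.range fun fg : (Fin j → Fin l) × (Fin j → Fin r) =>
    (M.submatrix fg.1 fg.2).det)

theorem minorIdeal_transpose (M : Matrix (Fin l) (Fin r) R) (j : ℕ) :
    minorIdeal Mᵀ j = minorIdeal M j := by
  unfold minorIdeal
  congr 1
  ext a
  constructor
  · rintro ⟨⟨f, g⟩, rfl⟩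
    exact ⟨(g, f), (det_transpose _).symm⟩
  · rintro ⟨⟨f, g⟩, rfl⟩
    exact ⟨(g, f), (det_transpose _).symm⟩

theorem minorIdeal_mul_le_right {m : ℕ} (U : Matrix (Fin m) (Fin l) R)
    (M : Matrix (Fin l) (Fin r) R) (j : ℕ) : minorIdeal (U * M) j ≤ minorIdeal M j := by
  unfold minorIdeal
  rw [Ideal.span_le]
  rintro _ ⟨⟨f, g⟩, rfl⟩
  -- multilinearity of the determinant in the rows
  have hrows : (U * M).submatrix f g =
      fun a => ∑ k, U (f a) k • fun b => M k (g b) := by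
    ext a b
    simp [Matrix.mul_apply]
  have hdet : ((U * M).submatrix f g).det =
      ∑ h : Fin j → Fin l, (∏ a, U (f a) (h a)) * (M.submatrix h g).det := by
    rw [hrows]
    change (detRowAlternating (n := Fin j) (R := R)).toMultilinearMap _ = _
    rw [MultilinearMap.map_sum]
    refine Finset.sum_congr rfl fun h _ => ?_
    rw [MultilinearMap.map_smul_univ]
    rfl
  change ((U * M).submatrix f g).det ∈ _
  rw [hdet]
  exact Ideal.sum_mem _ fun h _ => Ideal.mul_mem_left _ _ (Ideal.subset_span ⟨(h, g), rfl⟩)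

theorem minorIdeal_mul_le_left {m : ℕ} (M : Matrix (Fin l) (Fin r) R)
    (V : Matrix (Fin r) (Fin m) R) (j : ℕ) : minorIdeal (M * V) j ≤ minorIdeal M j := by
  rw [← minorIdeal_transpose, transpose_mul, ← minorIdeal_transpose M]
  exact minorIdeal_mul_le_right _ _ _

theorem UnimodularEquiv.minorIdeal_eq {M N : Matrix (Fin l) (Fin r) R}
    (h : UnimodularEquiv M N) (j : ℕ) : minorIdeal M j = minorIdeal N j := by
  have key : ∀ {M N : Matrix (Fin l) (Fin r) R}, UnimodularEquiv M N →
      minorIdeal N j ≤ minorIdeal M j := by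
    rintro M N ⟨U, V, -, -, rfl⟩
    exact (minorIdeal_mul_le_left _ _ _).trans (minorIdeal_mul_le_right _ _ _)
  exact le_antisymm (key h.symm) (key h)

/-- In a divisibility chain, the product of the first terms divides every product of equally many
distinct terms. -/
theorem prod_range_dvd_prod {d : ℕ → R} (hd : ∀ i, d i ∣ d (i + 1)) (s : Finset ℕ) :
    ∏ i ∈ Finset.range s.card, d i ∣ ∏ i ∈ s, d i := by
  have hmono : ∀ {a b : ℕ}, a ≤ b → d a ∣ d b := fun {a b} hab => by
    induction hab with
    | refl => exact dvd_rfl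
    | step _ ih => exact ih.trans (hd _)
  induction s using Finset.induction_on_max with
  | empty => simp
  | insert a s hmax ih =>
    have ha : a ∉ s := fun h => (hmax a h).false
    rw [Finset.card_insert_of_notMem ha, Finset.prod_range_succ, Finset.prod_insert ha, mul_comm]
    refine mul_dvd_mul (hmono ?_) ih
    have : s ⊆ Finset.range a := fun x hx => Finset.mem_range.2 (hmax x hx)
    simpa using Finset.card_le_card this

/-- The determinantal ideals of a diagonal matrix with a divisibility chain on its diagonal. -/
theorem minorIdeal_rectDiag {d : ℕ → R} (hd : ∀ i, d i ∣ d (i + 1)) {j : ℕ} (hl : j ≤ l)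
    (hr : j ≤ r) :
    minorIdeal (rectDiag l r d) j = Ideal.span {∏ i ∈ Finset.range j, d i} := by
  apply le_antisymm
  · unfold minorIdeal
    rw [Ideal.span_le]
    rintro _ ⟨⟨f, g⟩, rfl⟩
    change ((rectDiag l r d).submatrix f g).det ∈ _
    rw [SetLike.mem_coe, Ideal.mem_span_singleton]
    by_cases hf : Function.Injective f
    · rw [det_apply]
      refine Finset.dvd_sum fun σ _ => ?_
      rw [Units.smul_def, zsmul_eq_mul]
      refine Dvd.dvd.mul_left ?_ _
      by_cases hσ : ∀ a, (f (σ a) : ℕ) = g a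
      · have hinj : Function.Injective fun a => (f (σ a) : ℕ) :=
          Fin.val_injective.comp (hf.comp σ.injective)
        have := prod_range_dvd_prod hd (Finset.univ.image fun a => (f (σ a) : ℕ))
        rw [Finset.card_image_of_injective _ hinj, Finset.prod_image hinj.injOn, Finset.card_univ,
          Fintype.card_fin] at this
        refine this.trans (dvd_of_eq (Finset.prod_congr rfl fun a _ => ?_))
        simp [rectDiag, hσ a]
      · push Not at hσ
        obtain ⟨a, ha⟩ := hσ
        rw [Finset.prod_eq_zero (Finset.mem_univ a)]
        · exact dvd_zero _
        · simp [rectDiag, ha]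
    · rw [Function.not_injective_iff] at hf
      obtain ⟨a, b, hab, hne⟩ := hf
      rw [det_zero_of_row_eq hne]
      · exact dvd_zero _
      · funext k; simp [hab]
  · rw [Ideal.span_singleton_le_iff_mem]
    refine Ideal.subset_span ⟨(Fin.castLE hl, Fin.castLE hr), ?_⟩
    have : (rectDiag l r d).submatrix (Fin.castLE hl) (Fin.castLE hr) =
        diagonal fun i : Fin j => d i := by
      ext a b
      by_cases hab : a = b
      · subst hab; simp [rectDiag]
      · simp [rectDiag, hab, Fin.val_inj]
    change ((rectDiag l r d).submatrix (Fin.castLE hl) (Fin.castLE hr)).det = _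
    rw [this, det_diagonal, Finset.prod_range]

end Minors

/-- The rank of a rectangular diagonal matrix over a field whose nonzero entries come first. -/
theorem rank_rectDiag {F : Type*} [Field F] {l r m : ℕ} {d : ℕ → F} (hl : m ≤ l) (hr : m ≤ r)
    (hne : ∀ i, i < m → d i ≠ 0) (hzero : ∀ i, m ≤ i → d i = 0) : (rectDiag l r d).rank = m := by
  classical
  have hup : rectDiag l m (1 : ℕ → F) * diagonal (fun i : Fin m => d i) * rectDiag m r (1 : ℕ → F) =
      rectDiag l r d := by
    ext i j
    rw [Matrix.mul_apply]
    simp only [Matrix.mul_diagonal, rectDiag, of_apply, Pi.one_apply]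
    by_cases hi : (i : ℕ) < m
    · rw [Finset.sum_eq_single (⟨i, hi⟩ : Fin m)]
      · simp
      · intro b _ hb
        have : (i : ℕ) ≠ b := fun h => hb (Fin.ext h.symm)
        simp [this]
      · simp
    · rw [hzero i (not_lt.1 hi), ite_self]
      refine Finset.sum_eq_zero fun b _ => ?_
      have : (i : ℕ) ≠ b := by omega
      simp [this]
  have hdown : rectDiag m l (1 : ℕ → F) * rectDiag l r d * rectDiag r m (1 : ℕ → F) =
      diagonal (fun i : Fin m => d i) := by
    ext i j
    rw [Matrix.mul_apply, Finset.sum_eq_single (Fin.castLE hr j)]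
    · rw [Matrix.mul_apply, Finset.sum_eq_single (Fin.castLE hl i)]
      · by_cases hij : i = j
        · subst hij; simp [rectDiag]
        · simp [rectDiag, hij, Fin.val_inj]
      · intro b _ hb
        have : (i : ℕ) ≠ b := fun h => hb (Fin.ext h.symm)
        simp [rectDiag, this]
      · simp
    · intro b _ hb
      have : (b : ℕ) ≠ j := fun h => hb (Fin.ext h)
      simp [rectDiag, this]
    · simp
  apply le_antisymm
  · rw [← hup]
    exact (rank_mul_le_right _ _).trans (rank_le_height _)
  · calc m = (diagonal (fun i : Fin m => d i)).rank := by
          rw [rank_of_det_ne_zero, Fintype.card_fin]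
          rw [det_diagonal]
          exact Finset.prod_ne_zero_iff.2 fun i _ => hne i i.2
      _ ≤ _ := by
          rw [← hdown]
          exact (rank_mul_le_left _ _).trans (rank_mul_le_right _ _)

/-! ### Invariant polynomials from a Smith form -/

theorem aroots_eq_of_associated {p q : ℝ[X]} (h : Associated p q) :
    p.aroots ℂ = q.aroots ℂ := by
  simp only [aroots_def]
  exact (h.map (mapRingHom (algebraMap ℝ ℂ))).roots_eq

theorem aroots_prod_range {e : ℕ → ℝ[X]} {m : ℕ} (he : ∀ i < m, e i ≠ 0) :
    (∏ i ∈ Finset.range m, e i).aroots ℂ = ∑ i ∈ Finset.range m, (e i).aroots ℂ := by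
  induction m with
  | zero => simp
  | succ m ih =>
    rw [Finset.prod_range_succ, Finset.sum_range_succ, aroots_mul, ih fun i hi => he i (by omega)]
    exact mul_ne_zero (Finset.prod_ne_zero_iff.2 fun i hi =>
      he i (by rw [Finset.mem_range] at hi; omega)) (he m (by omega))

theorem toRat_mul {l m r : ℕ} (M : Matrix (Fin l) (Fin m) ℝ[X]) (N : Matrix (Fin m) (Fin r) ℝ[X]) :
    toRat (M * N) = toRat M * toRat N :=
  Matrix.map_mul

theorem toRat_injective {l r : ℕ} :
    Function.Injective (toRat : Matrix (Fin l) (Fin r) ℝ[X] → _) :=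
  Matrix.map_injective (RatFunc.algebraMap_injective ℝ)

theorem toRat_smul {l r : ℕ} (p : ℝ[X]) (M : Matrix (Fin l) (Fin r) ℝ[X]) :
    toRat (p • M) = algebraMap ℝ[X] (RatFunc ℝ) p • toRat M := by
  ext i j; simp [toRat]

theorem det_toRat {r : ℕ} (M : Matrix (Fin r) (Fin r) ℝ[X]) :
    (toRat M).det = algebraMap ℝ[X] (RatFunc ℝ) M.det :=
  (RingHom.map_det _ _).symm

theorem isUnit_det_toRat {r : ℕ} {M : Matrix (Fin r) (Fin r) ℝ[X]} (h : M.det ≠ 0) :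
    IsUnit (toRat M).det := by
  rw [det_toRat, isUnit_iff_ne_zero]
  exact RatFunc.algebraMap_ne_zero h

theorem toRat_rectDiag (l r : ℕ) (d : ℕ → ℝ[X]) :
    toRat (rectDiag l r d) = rectDiag l r fun i => algebraMap ℝ[X] (RatFunc ℝ) (d i) := by
  ext i j
  simp only [toRat, rectDiag, map_apply, of_apply]
  split <;> simp

theorem UnimodularEquiv.normalRank_eq {l r : ℕ} {M N : Matrix (Fin l) (Fin r) ℝ[X]}
    (h : UnimodularEquiv M N) : normalRank M = normalRank N := by
  obtain ⟨U, V, hU, hV, rfl⟩ := h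
  unfold normalRank
  rw [toRat_mul, toRat_mul, rank_mul_eq_left_of_isUnit_det _ _ (isUnit_det_toRat hV.ne_zero),
    rank_mul_eq_right_of_isUnit_det _ _ (isUnit_det_toRat hU.ne_zero)]

/-- `d` is a divisibility chain whose nonzero terms are exactly the first `m`, so that
`rectDiag l r d` is a Smith form of rank `m`. -/
structure IsSmithChain {R : Type*} [CommRing R] (d : ℕ → R) (m : ℕ) : Prop where
  dvd_succ : ∀ i, d i ∣ d (i + 1)
  ne_zero : ∀ i, i < m → d i ≠ 0
  eq_zero : ∀ i, m ≤ i → d i = 0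

theorem exists_isSmithChain {R : Type*} [EuclideanDomain R] {l r : ℕ}
    (M : Matrix (Fin l) (Fin r) R) :
    ∃ (d : ℕ → R) (m : ℕ), m ≤ l ∧ m ≤ r ∧ IsSmithChain d m ∧
      UnimodularEquiv M (rectDiag l r d) := by
  classical
  obtain ⟨d, hd, hchain, hzero⟩ := exists_smithForm M
  have hex : ∃ i, d i = 0 := ⟨_, hzero _ le_rfl⟩
  have hle : Nat.find hex ≤ min l r := Nat.find_min' hex (hzero _ le_rfl)
  refine ⟨d, Nat.find hex, hle.trans (min_le_left _ _), hle.trans (min_le_right _ _),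
    ⟨hchain, fun i hi => Nat.find_min hex hi, fun i hi => ?_⟩, hd⟩
  induction i, hi using Nat.le_induction with
  | base => exact Nat.find_spec hex
  | succ i _ ih => exact zero_dvd_iff.1 (ih ▸ hchain i)

section SmithForm

variable {l r m : ℕ} {M : Matrix (Fin l) (Fin r) ℝ[X]} {d : ℕ → ℝ[X]}

theorem normalRank_eq_of_smith (hl : m ≤ l) (hr : m ≤ r) (hd : IsSmithChain d m)
    (hM : UnimodularEquiv M (rectDiag l r d)) : normalRank M = m := by
  rw [hM.normalRank_eq, normalRank, toRat_rectDiag]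
  exact rank_rectDiag hl hr (fun i hi => RatFunc.algebraMap_ne_zero (hd.ne_zero i hi))
    fun i hi => by rw [hd.eq_zero i hi, map_zero]

theorem associated_detDivisor_of_smith {j : ℕ} (hl : j ≤ l) (hr : j ≤ r) (hd : IsSmithChain d m)
    (hM : UnimodularEquiv M (rectDiag l r d)) :
    Associated (detDivisor M j) (∏ i ∈ Finset.range j, d i) := by
  refine (normalize_associated _).trans ?_
  rw [← Ideal.span_singleton_eq_span_singleton, Ideal.span_singleton_generator]
  exact (hM.minorIdeal_eq j).trans (minorIdeal_rectDiag hd.dvd_succ hl hr)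

theorem associated_invariantPoly_of_smith {i : ℕ} (hl : m ≤ l) (hr : m ≤ r) (hi : i < m)
    (hd : IsSmithChain d m) (hM : UnimodularEquiv M (rectDiag l r d)) :
    Associated (invariantPoly M i) (d i) := by
  have h₁ : Associated (detDivisor M i) (∏ k ∈ Finset.range i, d k) :=
    associated_detDivisor_of_smith (by omega) (by omega) hd hM
  have h₂ : Associated (detDivisor M (i + 1)) (∏ k ∈ Finset.range (i + 1), d k) :=
    associated_detDivisor_of_smith (by omega) (by omega) hd hM
  have h0 : detDivisor M i ≠ 0 := h₁.ne_zero_iff.2 <| Finset.prod_ne_zero_iff.2 fun k hk =>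
    hd.ne_zero k (by rw [Finset.mem_range] at hk; omega)
  rw [Finset.prod_range_succ] at h₂
  have h₃ : Associated (detDivisor M (i + 1)) (detDivisor M i * d i) :=
    h₂.trans (h₁.symm.mul_right _)
  obtain ⟨u, hu⟩ := h₃.symm
  have : invariantPoly M i = d i * u := by
    rw [invariantPoly, ← hu, mul_assoc, mul_div_cancel_left₀ _ h0]
  rw [this]
  exact (associated_mul_unit_right _ _ u.isUnit).symm

theorem invariantZeros_eq_of_smith (hl : m ≤ l) (hr : m ≤ r) (hd : IsSmithChain d m)
    (hM : UnimodularEquiv M (rectDiag l r d)) :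
    invariantZeros M = ∑ i ∈ Finset.range m, (d i).aroots ℂ := by
  rw [invariantZeros, normalRank_eq_of_smith hl hr hd hM]
  exact Finset.sum_congr rfl fun i hi => aroots_eq_of_associated
    (associated_invariantPoly_of_smith hl hr (Finset.mem_range.1 hi) hd hM)

end SmithForm

/-! ### The Smith-McMillan form -/

theorem denom_dvd_leastCommonDenom {l r : ℕ} (W : Matrix (Fin l) (Fin r) (RatFunc ℝ))
    (i : Fin l) (j : Fin r) : (W i j).denom ∣ leastCommonDenom W := by
  rw [leastCommonDenom, dvd_normalize_iff, ← Ideal.mem_span_singleton]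
  exact (iInf_le (fun ij : Fin l × Fin r => Ideal.span {(W ij.1 ij.2).denom}) (i, j))
    (Submodule.IsPrincipal.generator_mem _)

theorem leastCommonDenom_ne_zero {l r : ℕ} (W : Matrix (Fin l) (Fin r) (RatFunc ℝ)) :
    leastCommonDenom W ≠ 0 := by
  rw [leastCommonDenom, Ne, normalize_eq_zero, ← Submodule.IsPrincipal.eq_bot_iff_generator_eq_zero]
  intro h
  have hmem : ∏ ij : Fin l × Fin r, (W ij.1 ij.2).denom ∈
      (⨅ ij : Fin l × Fin r, Ideal.span {(W ij.1 ij.2).denom} : Ideal ℝ[X]) := by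
    rw [Submodule.mem_iInf]
    intro ij
    exact Ideal.mem_span_singleton.2 (Finset.dvd_prod_of_mem _ (Finset.mem_univ ij))
  rw [h, Submodule.mem_bot, Finset.prod_eq_zero_iff] at hmem
  obtain ⟨ij, -, h0⟩ := hmem
  exact RatFunc.denom_ne_zero _ h0

theorem toRat_clearDenom {l r : ℕ} (W : Matrix (Fin l) (Fin r) (RatFunc ℝ)) :
    toRat (clearDenom W) = algebraMap ℝ[X] (RatFunc ℝ) (leastCommonDenom W) • W := by
  ext i j
  obtain ⟨q, hq⟩ := denom_dvd_leastCommonDenom W i j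
  have h0 := RatFunc.denom_ne_zero (W i j)
  have h1 : algebraMap ℝ[X] (RatFunc ℝ) (W i j).denom ≠ 0 := RatFunc.algebraMap_ne_zero h0
  simp only [toRat, clearDenom, map_apply, of_apply, Matrix.smul_apply, smul_eq_mul]
  have h2 : algebraMap ℝ[X] (RatFunc ℝ) (W i j).num =
      W i j * algebraMap ℝ[X] (RatFunc ℝ) (W i j).denom :=
    (div_eq_iff h1).1 (RatFunc.num_div_denom (W i j))
  rw [hq, mul_div_cancel_left₀ _ h0, map_mul, map_mul, h2]
  ring

theorem num_dvd_num_algebraMap_mul (q : ℝ[X]) (x : RatFunc ℝ) :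
    x.num ∣ (algebraMap ℝ[X] (RatFunc ℝ) q * x).num := by
  set y := algebraMap ℝ[X] (RatFunc ℝ) q * x with hy
  have h : y.num * x.denom = (q * x.num) * y.denom := by
    rw [RatFunc.num_mul_eq_mul_denom_iff (RatFunc.denom_ne_zero x), map_mul, mul_div_assoc,
      RatFunc.num_div_denom]
  refine (RatFunc.isCoprime_num_denom x).dvd_of_dvd_mul_right (Dvd.intro (q * y.denom) ?_)
  rw [h]; ring

/-- Two representations of a rational matrix as a fraction of polynomial matrices `K P⁻¹` which
satisfy a Bezout identity have equivalent numerators. -/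
theorem unimodularEquiv_of_bezout {l r : ℕ} {K K' : Matrix (Fin l) (Fin r) ℝ[X]}
    {P P' : Matrix (Fin r) (Fin r) ℝ[X]} {X₁ X₂ : Matrix (Fin r) (Fin l) ℝ[X]}
    {Y₁ Y₂ : Matrix (Fin r) (Fin r) ℝ[X]} {G : Matrix (Fin l) (Fin r) (RatFunc ℝ)}
    (hP : P.det ≠ 0) (hP' : P'.det ≠ 0)
    (hG : toRat K = G * toRat P) (hG' : toRat K' = G * toRat P')
    (hB : X₁ * K + Y₁ * P = 1) (hB' : X₂ * K' + Y₂ * P' = 1) : UnimodularEquiv K' K := by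
  have key : ∀ {K K' : Matrix (Fin l) (Fin r) ℝ[X]} {P P' : Matrix (Fin r) (Fin r) ℝ[X]}
      {X₂ : Matrix (Fin r) (Fin l) ℝ[X]} {Y₂ : Matrix (Fin r) (Fin r) ℝ[X]},
      P'.det ≠ 0 → toRat K = G * toRat P → toRat K' = G * toRat P' → X₂ * K' + Y₂ * P' = 1 →
      ∃ W : Matrix (Fin r) (Fin r) ℝ[X], K = K' * W ∧ P = P' * W := by
    intro K K' P P' X₂ Y₂ hP' hG hG' hB'
    have hPu := isUnit_det_toRat hP'
    have hPQ : toRat P = toRat P' * ((toRat P')⁻¹ * toRat P) := by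
      rw [← Matrix.mul_assoc, mul_nonsing_inv _ hPu, Matrix.one_mul]
    have hKQ : toRat K = toRat K' * ((toRat P')⁻¹ * toRat P) := by
      rw [hG', Matrix.mul_assoc, ← hPQ, hG]
    -- the rational quotient `P'⁻¹ P` is a polynomial matrix, by the Bezout identity
    have hQ : toRat (X₂ * K + Y₂ * P) = (toRat P')⁻¹ * toRat P := by
      have h1 : toRat (X₂ * K') + toRat (Y₂ * P') = 1 := by
        have := congrArg toRat hB'
        simpa [toRat, Matrix.map_add] using this
      have h2 : toRat (X₂ * K + Y₂ * P) = toRat (X₂ * K) + toRat (Y₂ * P) := by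
        simp [toRat, Matrix.map_add]
      generalize (toRat P')⁻¹ * toRat P = Q at hPQ hKQ ⊢
      rw [h2, toRat_mul, toRat_mul, hKQ, hPQ, ← Matrix.mul_assoc, ← Matrix.mul_assoc, ← toRat_mul,
        ← toRat_mul, ← Matrix.add_mul, h1, Matrix.one_mul]
    refine ⟨X₂ * K + Y₂ * P, toRat_injective ?_, toRat_injective ?_⟩
    · rw [toRat_mul, hQ, ← hKQ]
    · rw [toRat_mul, hQ, ← hPQ]
  obtain ⟨W, hKW, hPW⟩ := key hP' hG hG' hB'
  obtain ⟨W', hKW', hPW'⟩ := key hP hG' hG hB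
  have hone : W * W' = 1 := by
    calc W * W' = (X₂ * K' + Y₂ * P') * (W * W') := by rw [hB', Matrix.one_mul]
      _ = X₂ * (K' * W * W') + Y₂ * (P' * W * W') := by
          simp only [Matrix.add_mul, Matrix.mul_assoc]
      _ = 1 := by rw [← hKW, ← hPW, ← hKW', ← hPW', hB']
  rw [hKW]
  exact UnimodularEquiv.mul_right ((isUnit_iff_isUnit_det W).1 (IsUnit.of_mul_eq_one _ hone)) K'

/-- The numerators of the Smith-McMillan form constitute a Smith form of the numerator of any
fraction `K P⁻¹` with a Bezout identity. -/
theorem exists_smith_transmissionZeros {l r : ℕ} {K : Matrix (Fin l) (Fin r) ℝ[X]}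
    {P : Matrix (Fin r) (Fin r) ℝ[X]} {X₁ : Matrix (Fin r) (Fin l) ℝ[X]}
    {Y₁ : Matrix (Fin r) (Fin r) ℝ[X]} {G : Matrix (Fin l) (Fin r) (RatFunc ℝ)}
    (hP : P.det ≠ 0) (hG : G = toRat K * (toRat P)⁻¹) (hB : X₁ * K + Y₁ * P = 1) :
    ∃ e : ℕ → ℝ[X], G.rank ≤ l ∧ G.rank ≤ r ∧ IsSmithChain e G.rank ∧
      UnimodularEquiv K (rectDiag l r e) ∧
      transmissionZeros G = ∑ i ∈ Finset.range G.rank, (e i).aroots ℂ := by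
  obtain ⟨σ, m, hl, hr, hσ, hT⟩ := exists_isSmithChain (clearDenom G)
  set φ := leastCommonDenom G with hφ
  have hφ0 : φ ≠ 0 := leastCommonDenom_ne_zero G
  have hφ1 : algebraMap ℝ[X] (RatFunc ℝ) φ ≠ 0 := RatFunc.algebraMap_ne_zero hφ0
  have hrank : G.rank = m := by
    rw [← normalRank_eq_of_smith hl hr hσ hT, normalRank, toRat_clearDenom,
      rank_smul_of_mem_nonZeroDivisors _ (mem_nonZeroDivisors_of_ne_zero hφ1)]
  rw [hrank]
  let x : ℕ → RatFunc ℝ := fun i =>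
    algebraMap ℝ[X] (RatFunc ℝ) (σ i) / algebraMap ℝ[X] (RatFunc ℝ) φ
  have hx : ∀ i, (x i).num * φ = σ i * (x i).denom := fun i =>
    (RatFunc.num_mul_eq_mul_denom_iff hφ0).2 rfl
  have hchain : IsSmithChain (fun i => (x i).num) m := by
    refine ⟨fun i => ?_, fun i hi => ?_, fun i hi => ?_⟩
    · obtain ⟨q, hq⟩ := hσ.dvd_succ i
      have : x (i + 1) = algebraMap ℝ[X] (RatFunc ℝ) q * x i := by
        simp only [x, hq, map_mul]; ring
      rw [this]
      exact num_dvd_num_algebraMap_mul q (x i)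
    · exact RatFunc.num_ne_zero
        (div_ne_zero (RatFunc.algebraMap_ne_zero (hσ.ne_zero i hi)) hφ1)
    · simp [x, hσ.eq_zero i hi]
  refine ⟨fun i => (x i).num, hl, hr, hchain, ?_, ?_⟩
  · obtain ⟨U, V, hU, hV, hUV⟩ := hT
    have hcop : ∀ i, ∃ a b : ℝ[X], a * (x i).num + b * (x i).denom = 1 := fun i =>
      RatFunc.isCoprime_num_denom (x i)
    choose a b hab using hcop
    -- `G = K' P'⁻¹` with the numerators of the Smith-McMillan form in `K'` and its denominators
    -- in `P'`
    set K' := U⁻¹ * rectDiag l r (fun i => (x i).num) with hK'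
    set P' := V * diagonal (fun j : Fin r => (x j).denom) with hP'
    have hdet : P'.det ≠ 0 := by
      rw [hP', det_mul, det_diagonal]
      exact mul_ne_zero hV.ne_zero (Finset.prod_ne_zero_iff.2 fun i _ => RatFunc.denom_ne_zero _)
    have hKP : φ • K' = clearDenom G * P' := by
      have h1 : φ • rectDiag l r (fun i => (x i).num) =
          rectDiag l r σ * diagonal (fun j : Fin r => (x j).denom) := by
        ext i j
        simp only [Matrix.smul_apply, mul_diagonal, rectDiag, of_apply, smul_eq_mul]
        split_ifs with hij
        · rw [mul_comm, hx, hij]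
        · simp
      rw [hK', ← Matrix.mul_smul, h1, ← hUV, hP', ← Matrix.mul_assoc, ← Matrix.mul_assoc,
        ← Matrix.mul_assoc, ← Matrix.mul_assoc, nonsing_inv_mul _ hU, Matrix.one_mul]
    have hG' : toRat K' = G * toRat P' := by
      have h2 := congrArg toRat hKP
      rw [toRat_smul, toRat_mul _ P', toRat_clearDenom, Matrix.smul_mul] at h2
      exact smul_right_injective _ hφ1 h2
    have hB' : (rectDiag r l a * U) * K' + (diagonal (fun j : Fin r => b j) * V⁻¹) * P' = 1 := by
      rw [hK', hP', Matrix.mul_assoc, ← Matrix.mul_assoc U, mul_nonsing_inv _ hU, Matrix.one_mul,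
        Matrix.mul_assoc, ← Matrix.mul_assoc V⁻¹, nonsing_inv_mul _ hV, Matrix.one_mul,
        diagonal_mul_diagonal]
      have h3 : rectDiag r l a * rectDiag l r (fun i => (x i).num) =
          diagonal fun j : Fin r => a j * (x j).num := by
        ext i j
        rw [Matrix.mul_apply]
        by_cases hi : (i : ℕ) < l
        · rw [Finset.sum_eq_single (⟨i, hi⟩ : Fin l)]
          · by_cases hij : i = j
            · subst hij; simp [rectDiag]
            · simp [rectDiag, hij, Fin.val_inj]
          · intro k _ hk
            have : (i : ℕ) ≠ k := fun h => hk (Fin.ext h.symm)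
            simp [rectDiag, this]
          · simp
        · rw [Finset.sum_eq_zero fun k _ => ?_]
          · by_cases hij : i = j
            · subst hij
              rw [diagonal_apply_eq, hchain.eq_zero i (by omega), mul_zero]
            · rw [diagonal_apply_ne _ hij]
          · have : (i : ℕ) ≠ k := by omega
            simp [rectDiag, this]
      rw [h3, diagonal_add, ← diagonal_one]
      exact congrArg diagonal (funext fun j => hab j)
    have hG1 : toRat K = G * toRat P := by
      rw [hG, Matrix.mul_assoc, nonsing_inv_mul _ (isUnit_det_toRat hP), Matrix.mul_one]
    exact (unimodularEquiv_of_bezout hdet hP hG' hG1 hB' hB).trans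
      (UnimodularEquiv.symm (UnimodularEquiv.mul_left (by
        rw [isUnit_nonsing_inv_det_iff]; exact hU) _))
  · rw [transmissionZeros, hrank]
    refine Finset.sum_congr rfl fun i hi => aroots_eq_of_associated ?_
    have hass := associated_invariantPoly_of_smith hl hr (Finset.mem_range.1 hi) hσ hT
    have hdvd : ∀ {p q : ℝ[X]}, p ∣ q →
        (algebraMap ℝ[X] (RatFunc ℝ) p / algebraMap ℝ[X] (RatFunc ℝ) φ).num ∣
          (algebraMap ℝ[X] (RatFunc ℝ) q / algebraMap ℝ[X] (RatFunc ℝ) φ).num := by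
      rintro p _ ⟨c, rfl⟩
      rw [mul_comm, map_mul, mul_div_assoc]
      exact num_dvd_num_algebraMap_mul _ _
    exact associated_of_dvd_dvd (hdvd hass.dvd) (hdvd hass.symm.dvd)

theorem transmissionZeros_eq_invariantZeros {l r : ℕ} {K : Matrix (Fin l) (Fin r) ℝ[X]}
    {P : Matrix (Fin r) (Fin r) ℝ[X]} {X₁ : Matrix (Fin r) (Fin l) ℝ[X]}
    {Y₁ : Matrix (Fin r) (Fin r) ℝ[X]} {G : Matrix (Fin l) (Fin r) (RatFunc ℝ)}
    (hP : P.det ≠ 0) (hG : G = toRat K * (toRat P)⁻¹) (hB : X₁ * K + Y₁ * P = 1) :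
    transmissionZeros G = invariantZeros K := by
  obtain ⟨e, hl, hr, he, hK, hz⟩ := exists_smith_transmissionZeros hP hG hB
  rw [hz, invariantZeros_eq_of_smith hl hr he hK]

theorem transmissionZeros_eq_aroots_det {r : ℕ} {K : Matrix (Fin r) (Fin r) ℝ[X]}
    {P : Matrix (Fin r) (Fin r) ℝ[X]} {X₁ : Matrix (Fin r) (Fin r) ℝ[X]}
    {Y₁ : Matrix (Fin r) (Fin r) ℝ[X]} {G : Matrix (Fin r) (Fin r) (RatFunc ℝ)}
    (hP : P.det ≠ 0) (hG : G = toRat K * (toRat P)⁻¹) (hB : X₁ * K + Y₁ * P = 1)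
    (hrank : G.rank = r) :
    K.det ≠ 0 ∧ transmissionZeros G = K.det.aroots ℂ := by
  obtain ⟨e, -, -, he, ⟨U, V, hU, hV, hK⟩, hz⟩ := exists_smith_transmissionZeros hP hG hB
  rw [hrank] at he hz
  have hdiag : rectDiag r r e = diagonal fun i : Fin r => e i := by
    ext i j
    by_cases hij : i = j
    · subst hij; simp [rectDiag]
    · simp [rectDiag, hij, Fin.val_inj]
  have hdet : U.det * K.det * V.det = ∏ i ∈ Finset.range r, e i := by
    rw [← det_mul, ← det_mul, hK, hdiag, det_diagonal, Finset.prod_range]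
  have hass : Associated K.det (∏ i ∈ Finset.range r, e i) := by
    rw [← hdet]
    exact (associated_unit_mul_right _ _ hU).trans (associated_mul_unit_right _ _ hV)
  refine ⟨hass.ne_zero_iff.2 (Finset.prod_ne_zero_iff.2 fun i hi =>
    he.ne_zero i (Finset.mem_range.1 hi)), ?_⟩
  rw [hz, aroots_eq_of_associated hass, aroots_prod_range he.ne_zero]

/-- A Bezout identity makes the identity matrix a greatest common right divisor. -/
theorem relativelyRightPrime_of_bezout {l r : ℕ} {K : Matrix (Fin l) (Fin r) ℝ[X]}
    {P : Matrix (Fin r) (Fin r) ℝ[X]} {X₁ : Matrix (Fin r) (Fin l) ℝ[X]}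
    {Y₁ : Matrix (Fin r) (Fin r) ℝ[X]} (hB : X₁ * K + Y₁ * P = 1) :
    RelativelyRightPrime K P := by
  refine ⟨1, ⟨⟨⟨K, by simp⟩, P, by simp⟩, ?_⟩, 1, one_ne_zero, by simp⟩
  rintro D ⟨⟨K₁, rfl⟩, P₁, rfl⟩
  exact ⟨X₁ * K₁ + Y₁ * P₁, by rw [← hB, Matrix.add_mul, Matrix.mul_assoc, Matrix.mul_assoc]⟩

/-! ### The rank conditions for controllability and observability -/

/-- Every power of `A` is a combination of the first `n` powers (Cayley-Hamilton). -/
theorem pow_eq_sum_coeff_smul {n : ℕ} (A : Matrix (Fin n) (Fin n) ℝ) (k : ℕ) :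
    A ^ k = ∑ j : Fin n, ((X : ℝ[X]) ^ k %ₘ A.charpoly).coeff j • A ^ (j : ℕ) := by
  rcases Nat.eq_zero_or_pos n with rfl | hn
  · exact Subsingleton.elim _ _
  have hdeg : ((X : ℝ[X]) ^ k %ₘ A.charpoly).natDegree < n := by
    have h1 : A.charpoly.natDegree = n := by simp
    have h2 := natDegree_modByMonic_lt ((X : ℝ[X]) ^ k) A.charpoly_monic (q := A.charpoly)
      (fun h => by rw [h, natDegree_one] at h1; omega)
    rwa [h1] at h2
  conv_lhs => rw [pow_eq_aeval_mod_charpoly, aeval_eq_sum_range' hdeg]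
  rw [Finset.sum_range]

/-- The quantities `w Aⁱ x(t)`, `i < n`, solve a homogeneous linear differential equation as soon
as `w` annihilates all `Aᵏ B`; hence they vanish identically if they do so initially. -/
theorem dotProduct_trajectory_eq_zero {n r : ℕ} {A : Matrix (Fin n) (Fin n) ℝ}
    {B : Matrix (Fin n) (Fin r) ℝ} {t₀ t₁ : ℝ} {u : ℝ → Fin r → ℝ} {x : ℝ → Fin n → ℝ}
    (hx : IsTrajectory A B t₀ t₁ u x) (w : Fin n → ℝ) (hB : ∀ k : ℕ, w ᵥ* (A ^ k * B) = 0)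
    (h₀ : ∀ k : ℕ, (w ᵥ* A ^ k) ⬝ᵥ x t₀ = 0) {t : ℝ} (ht : t ∈ Set.Icc t₀ t₁) :
    w ⬝ᵥ x t = 0 := by
  rcases Nat.eq_zero_or_pos n with rfl | hn
  · simp [dotProduct]
  let O : Matrix (Fin n) (Fin n) ℝ := Matrix.of fun i => w ᵥ* A ^ (i : ℕ)
  let M : Matrix (Fin n) (Fin n) ℝ :=
    Matrix.of fun i j => ((X : ℝ[X]) ^ ((i : ℕ) + 1) %ₘ A.charpoly).coeff j
  have hOA : O * A = M * O := by
    ext i j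
    have h1 : (O * A) i = w ᵥ* A ^ ((i : ℕ) + 1) := by
      rw [pow_succ, ← vecMul_vecMul]; rfl
    rw [h1, pow_eq_sum_coeff_smul A, vecMul_sum, Finset.sum_apply, Matrix.mul_apply]
    exact Finset.sum_congr rfl fun k _ => by simp [M, O, vecMul_smul]
  have hOB : O * B = 0 := by
    ext i j
    have h1 : (O * B) i = w ᵥ* (A ^ (i : ℕ) * B) := by
      rw [← vecMul_vecMul]; rfl
    rw [h1, hB]; rfl
  let L := (mulVecLin O).toContinuousLinearMap
  let LM := (mulVecLin M).toContinuousLinearMap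
  have hderiv : ∀ s ∈ Set.Icc t₀ t₁,
      HasDerivWithinAt (fun s => L (x s)) (LM (L (x s))) (Set.Icc t₀ t₁) s := by
    intro s hs
    have h1 := L.hasFDerivAt.comp_hasDerivWithinAt s (hx.2 s hs)
    have h2 : L (A *ᵥ x s + B *ᵥ u s) = LM (L (x s)) := by
      change O *ᵥ (A *ᵥ x s + B *ᵥ u s) = M *ᵥ (O *ᵥ x s)
      rw [mulVec_add, mulVec_mulVec, mulVec_mulVec, mulVec_mulVec, hOA, hOB, zero_mulVec, add_zero]
    rwa [h2] at h1
  have hzero : Set.EqOn (fun s => L (x s)) (fun _ => 0) (Set.Icc t₀ t₁) := by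
    refine ODE_solution_unique_of_mem_Icc_right (v := fun _ y => LM y) (s := fun _ => Set.univ)
      (fun _ _ => LM.lipschitz.lipschitzOnWith) (fun s hs => (hderiv s hs).continuousWithinAt)
      (fun s hs => ?_) (fun _ _ => trivial) continuousOn_const (fun s _ => ?_)
      (fun _ _ => trivial) ?_
    · exact (hderiv s (Set.Ico_subset_Icc_self hs)).mono_of_mem_nhdsWithin
        (Icc_mem_nhdsGE_of_mem hs)
    · simpa using hasDerivWithinAt_const (c := (0 : Fin n → ℝ)) s (Set.Ici s)
    · funext i
      exact h₀ i
  have := congrFun (hzero ht) ⟨0, hn⟩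
  simpa [L, O, mulVec] using this

/-- A controllable pair has a controllability matrix of full rank. -/
theorem Controllable.rank_ctrbMatrix {n r : ℕ} {A : Matrix (Fin n) (Fin n) ℝ}
    {B : Matrix (Fin n) (Fin r) ℝ} (h : Controllable A B) : (ctrbMatrix A B n).rank = n := by
  have hinj : Function.Injective (ctrbMatrix A B n).vecMul := by
    change Function.Injective (Matrix.vecMulLinear (ctrbMatrix A B n))
    rw [injective_iff_map_eq_zero (Matrix.vecMulLinear (ctrbMatrix A B n))]
    intro w hw
    have hlt : ∀ k : Fin n, w ᵥ* (A ^ (k : ℕ) * B) = 0 := fun k => by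
      funext c
      exact congrFun hw (k, c)
    have hB : ∀ k : ℕ, w ᵥ* (A ^ k * B) = 0 := fun k => by
      rw [pow_eq_sum_coeff_smul A k, Matrix.sum_mul, vecMul_sum]
      exact Finset.sum_eq_zero fun j _ => by
        rw [Matrix.smul_mul, vecMul_smul, hlt, smul_zero]
    obtain ⟨u, x, hx, h₀, h₁⟩ := h 0 1 zero_lt_one 0 w
    have := dotProduct_trajectory_eq_zero hx w hB (fun k => by rw [h₀, dotProduct_zero])
      (Set.right_mem_Icc.2 zero_le_one)
    rwa [h₁, dotProduct_self_eq_zero] at this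
  simpa using (Matrix.vecMul_injective_iff.1 hinj).rank_matrix

theorem exists_free_trajectory {n r : ℕ} (A : Matrix (Fin n) (Fin n) ℝ)
    (v : Fin n → ℝ) : ∃ x : ℝ → Fin n → ℝ, x 0 = v ∧
      ∀ (B : Matrix (Fin n) (Fin r) ℝ) (t₁ : ℝ), IsTrajectory A B 0 t₁ 0 x := by
  let _ : NormedRing (Matrix (Fin n) (Fin n) ℝ) := Matrix.linftyOpNormedRing
  let _ : NormedAlgebra ℝ (Matrix (Fin n) (Fin n) ℝ) := Matrix.linftyOpNormedAlgebra
  let L : Matrix (Fin n) (Fin n) ℝ →L[ℝ] (Fin n → ℝ) :=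
    ((Matrix.mulVecBilin ℝ ℝ).flip v).toContinuousLinearMap
  refine ⟨fun t => L (NormedSpace.exp (t • A)), ?_, fun B t₁ => ⟨continuousOn_const, ?_⟩⟩
  · simp [L]
  · intro t _
    have h := L.hasFDerivAt.comp_hasDerivAt t (hasDerivAt_exp_smul_const' A t)
    have h2 : L (A * NormedSpace.exp (t • A)) =
        A *ᵥ L (NormedSpace.exp (t • A)) + B *ᵥ (0 : ℝ → Fin r → ℝ) t := by
      simp [L]
    exact (h.congr_deriv h2).hasDerivWithinAt

/-- The states of an observable system are separated by the outputs `C Aᵏ`. -/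
theorem Observable.eq_zero_of_forall_pow {n r l : ℕ} {A : Matrix (Fin n) (Fin n) ℝ}
    {B : Matrix (Fin n) (Fin r) ℝ} {C : Matrix (Fin l) (Fin n) ℝ} (h : Observable A B C)
    {v : Fin n → ℝ} (hv : ∀ k : ℕ, (C * A ^ k) *ᵥ v = 0) : v = 0 := by
  obtain ⟨x, h₀, hx⟩ := exists_free_trajectory (r := r) A v
  obtain ⟨x', h₀', hx'⟩ := exists_free_trajectory (r := r) A 0
  have hout : ∀ t ∈ Set.Icc (0 : ℝ) 1, ∀ (y : ℝ → Fin n → ℝ),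
      (∀ k : ℕ, (C * A ^ k) *ᵥ y 0 = 0) →
      (∀ (B : Matrix (Fin n) (Fin r) ℝ) (t₁ : ℝ), IsTrajectory A B 0 t₁ 0 y) → C *ᵥ y t = 0 := by
    intro t ht y hy₀ hy
    funext i
    refine dotProduct_trajectory_eq_zero (hy 0 1) (C i) (fun k => by simp) (fun k => ?_) ht
    exact congrFun (hy₀ k) i
  have := h 0 1 le_rfl zero_lt_one 0 x x' (hx B 1) (hx' B 1)
    (fun t ht => by rw [hout t ht x (by rwa [h₀]) hx, hout t ht x' (by simp [h₀']) hx'])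
    0 (Set.left_mem_Icc.2 zero_le_one)
  rwa [h₀, h₀'] at this

/-! ### The block companion form -/

section Companion

variable {n ν r l : ℕ} (hn : n = ν * r) {A : Matrix (Fin n) (Fin n) ℝ}
  {B : Matrix (Fin n) (Fin r) ℝ}

/-- The square matrix `[B, AB, …, A^{ν-1} B]`. -/
def ctrbSquare (A : Matrix (Fin n) (Fin n) ℝ) (B : Matrix (Fin n) (Fin r) ℝ) :
    Matrix (Fin n) (Fin n) ℝ :=
  (ctrbMatrix A B ν).submatrix id (blockEquiv hn).symm

theorem isUnit_det_ctrbSquare (hrank : (ctrbMatrix A B ν).rank = n) :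
    IsUnit (ctrbSquare hn A B).det := by
  have h : (ctrbSquare hn A B).rank = n := by
    refine Eq.trans ?_ hrank
    exact rank_submatrix (ctrbMatrix A B ν) (Equiv.refl _) (blockEquiv hn).symm
  rw [← isUnit_iff_isUnit_det, ← mulVec_surjective_iff_isUnit]
  change Function.Surjective (ctrbSquare hn A B).mulVecLin
  rw [← LinearMap.range_eq_top]
  apply Submodule.eq_top_of_finrank_eq
  rw [Module.finrank_fin_fun]
  exact h

theorem lastBlock_apply (a c : Fin r) (j : Fin ν) :
    lastBlock hn a (blockEquiv hn (j, c)) = if (j : ℕ) + 1 = ν ∧ c = a then 1 else 0 := by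
  simp [lastBlock]

theorem lastBlock_mul {m : ℕ} (M : Matrix (Fin n) (Fin m) ℝ) {i : Fin ν} (hi : (i : ℕ) + 1 = ν)
    (a : Fin r) : (lastBlock hn * M) a = M (blockEquiv hn (i, a)) := by
  funext c
  rw [Matrix.mul_apply, Finset.sum_eq_single (blockEquiv hn (i, a))]
  · simp [lastBlock_apply, hi]
  · intro k _ hk
    obtain ⟨⟨j, b⟩, rfl⟩ := (blockEquiv hn).surjective k
    rw [lastBlock_apply, if_neg, zero_mul]
    rintro ⟨hj, rfl⟩
    exact hk (by rw [Fin.ext (by omega : (j : ℕ) = i)])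
  · simp

theorem topBlock_mul_pow_mul (hQ : IsUnit (ctrbSquare hn A B).det) {j : ℕ} (hj : j < ν) :
    topBlock hn A B * (A ^ j * B) = if j + 1 = ν then 1 else 0 := by
  have h : topBlock hn A B * ctrbSquare hn A B = lastBlock hn := by
    rw [topBlock, Matrix.mul_assoc]
    exact (congrArg _ (nonsing_inv_mul _ hQ)).trans (Matrix.mul_one _)
  ext a c
  have h1 := congrFun (congrFun h a) (blockEquiv hn (⟨j, hj⟩, c))
  rw [lastBlock_apply] at h1
  have h2 : (topBlock hn A B * ctrbSquare hn A B) a (blockEquiv hn (⟨j, hj⟩, c)) =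
      (topBlock hn A B * (A ^ j * B)) a c := by
    simp [Matrix.mul_apply (M := topBlock hn A B), ctrbSquare, ctrbMatrix]
  rw [← h2, h1]
  by_cases hν : j + 1 = ν <;> simp [hν, Matrix.one_apply, eq_comm]

theorem transformation_mul_apply {m : ℕ} (M : Matrix (Fin n) (Fin m) ℝ) (i : Fin ν) (a : Fin r) :
    (transformation hn A B * M) (blockEquiv hn (i, a)) =
      (topBlock hn A B * (A ^ (i : ℕ) * M)) a := by
  funext c
  rw [← Matrix.mul_assoc, Matrix.mul_apply, Matrix.mul_apply]
  simp [transformation]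

/-- The product of `N` with `[A^{ν-1} B, …, AB, B]` is block lower unitriangular. -/
theorem isUnit_det_transformation (hQ : IsUnit (ctrbSquare hn A B).det) :
    IsUnit (transformation hn A B).det := by
  let e := blockEquiv hn
  let M : Matrix (Fin ν × Fin r) (Fin ν × Fin r) ℝ :=
    (transformation hn A B).submatrix e e *
      (ctrbMatrix A B ν).submatrix e fun q => (Fin.rev q.1, q.2)
  have hM : ∀ p q, M p q = (topBlock hn A B * (A ^ ((p.1 : ℕ) + (Fin.rev q.1 : ℕ)) * B)) p.2 q.2 :=
    fun p q => by
      rw [pow_add, Matrix.mul_assoc, ← transformation_mul_apply]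
      simp only [M]
      rw [submatrix_mul_equiv]
      rfl
  have htri : M.BlockTriangular (OrderDual.toDual ∘ Prod.fst) := by
    rintro ⟨i, a⟩ ⟨j, c⟩ hij
    have hij' : i < j := hij
    have h1 : (i : ℕ) < j := hij'
    rw [hM, topBlock_mul_pow_mul hn hQ (by simp only [Fin.val_rev]; omega), if_neg]
    · rfl
    · simp only [Fin.val_rev]; omega
  have hdet : M.det = 1 := by
    rw [htri.det_fintype]
    refine Finset.prod_eq_one fun k _ => ?_
    have hone : M.toSquareBlock (OrderDual.toDual ∘ Prod.fst) k = 1 := ?_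
    · rw [hone, det_one]
    ext ⟨⟨i, a⟩, hi⟩ ⟨⟨j, c⟩, hj⟩
    have hi' : i = OrderDual.ofDual k := hi
    have hj' : j = OrderDual.ofDual k := hj
    obtain rfl : j = i := hj'.trans hi'.symm
    have hlt := j.isLt
    change M _ _ = _
    rw [hM, topBlock_mul_pow_mul hn hQ (by simp only [Fin.val_rev]; omega), if_pos]
    · simp [Matrix.one_apply]
    · simp only [Fin.val_rev]; omega
  rw [det_mul, det_submatrix_equiv_self] at hdet
  exact IsUnit.of_mul_eq_one _ hdet

theorem AStar_apply_of_lt (hN : IsUnit (transformation hn A B).det) {i j : Fin ν}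
    (hij : (j : ℕ) = i + 1) (a : Fin r) :
    AStar hn A B (blockEquiv hn (i, a)) = (1 : Matrix _ _ ℝ) (blockEquiv hn (j, a)) := by
  rw [AStar, Matrix.mul_assoc, transformation_mul_apply, ← Matrix.mul_assoc (A ^ (i : ℕ)), ← pow_succ,
    ← hij,
    ← transformation_mul_apply, mul_nonsing_inv _ hN]

theorem AStar_eq_blockCompanion (hN : IsUnit (transformation hn A B).det) :
    AStar hn A B = blockCompanion hn (AStarTwo hn A B) := by
  ext p q
  obtain ⟨⟨i, a⟩, rfl⟩ := (blockEquiv hn).surjective p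
  obtain ⟨⟨j, b⟩, rfl⟩ := (blockEquiv hn).surjective q
  simp only [blockCompanion, submatrix_apply, Equiv.symm_apply_apply, of_apply]
  split_ifs with hi hij
  · simp [AStarTwo, colBlock, lastBlock_mul hn _ hi]
  · obtain ⟨hij, rfl⟩ := hij
    rw [AStar_apply_of_lt hn hN hij, Matrix.one_apply_eq]
  · rw [AStar_apply_of_lt hn hN (j := ⟨i + 1, by omega⟩) rfl, Matrix.one_apply_ne]
    intro h
    have h1 := (blockEquiv hn).injective h
    simp only [Prod.mk.injEq] at h1
    exact hij ⟨by rw [← h1.1], h1.2.symm⟩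

theorem BStar_eq_transpose_lastBlock (hQ : IsUnit (ctrbSquare hn A B).det) :
    BStar hn A B = (lastBlock hn)ᵀ := by
  ext p c
  obtain ⟨⟨i, a⟩, rfl⟩ := (blockEquiv hn).surjective p
  rw [BStar, transformation_mul_apply, topBlock_mul_pow_mul hn hQ i.isLt, transpose_apply,
    lastBlock_apply]
  by_cases hν : (i : ℕ) + 1 = ν <;> simp [hν, Matrix.one_apply]

/-! ### The matrix fraction of the companion form -/

/-- The block column `[I, sI, …, s^{ν-1} I]`. -/
def powerColumn : Matrix (Fin n) (Fin r) ℝ[X] :=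
  Matrix.of fun k c =>
    if ((blockEquiv hn).symm k).2 = c then X ^ (((blockEquiv hn).symm k).1 : ℕ) else 0

theorem powerColumn_apply (i : Fin ν) (a c : Fin r) :
    powerColumn hn (blockEquiv hn (i, a)) c = if a = c then X ^ (i : ℕ) else 0 := by
  simp [powerColumn]

theorem map_mul_powerColumn {m : ℕ} (M : Matrix (Fin m) (Fin n) ℝ) :
    M.map Polynomial.C * powerColumn hn =
      ∑ i : Fin ν, (X : ℝ[X]) ^ (i : ℕ) • (colBlock hn M i).map Polynomial.C := by
  ext1 a c
  rw [Matrix.mul_apply, ← (blockEquiv hn).sum_comp, Fintype.sum_prod_type, Matrix.sum_apply]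
  refine Finset.sum_congr rfl fun i _ => ?_
  rw [Matrix.smul_apply, smul_eq_mul, mul_comm, Finset.sum_eq_single c]
  · rw [powerColumn_apply, if_pos rfl]; rfl
  · intro b _ hb
    rw [powerColumn_apply, if_neg hb, mul_zero]
  · simp

theorem numPoly_eq (C : Matrix (Fin l) (Fin n) ℝ) :
    numPoly hn A B C = (CStar hn A B C).map Polynomial.C * powerColumn hn :=
  (map_mul_powerColumn hn _).symm

theorem denPoly_eq : denPoly hn A B =
    (X : ℝ[X]) ^ ν • (1 : Matrix (Fin r) (Fin r) ℝ[X]) -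
      (lastBlock hn * AStar hn A B).map Polynomial.C * powerColumn hn := by
  rw [map_mul_powerColumn, denPoly, add_comm, sub_eq_add_neg, ← Finset.sum_neg_distrib]
  congr 1
  refine Finset.sum_congr rfl fun i _ => ?_
  rw [← smul_neg]
  congr 1
  ext1 a c
  simp only [AStarTwo, map_apply, Matrix.neg_apply, Polynomial.C_neg]

theorem charmatrix_eq {n : ℕ} (M : Matrix (Fin n) (Fin n) ℝ) : charmatrix M =
    (X : ℝ[X]) • (1 : Matrix (Fin n) (Fin n) ℝ[X]) - M.map Polynomial.C := by
  rw [charmatrix, smul_one_eq_diagonal]; rfl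

theorem charmatrix_AStar_mul_powerColumn (hN : IsUnit (transformation hn A B).det)
    (hB : BStar hn A B = (lastBlock hn)ᵀ) :
    charmatrix (AStar hn A B) * powerColumn hn =
      (BStar hn A B).map Polynomial.C * denPoly hn A B := by
  rw [charmatrix_eq, Matrix.sub_mul, Matrix.smul_mul, Matrix.one_mul]
  ext1 p c
  obtain ⟨⟨i, a⟩, rfl⟩ := (blockEquiv hn).surjective p
  have hright : ((BStar hn A B).map Polynomial.C * denPoly hn A B) (blockEquiv hn (i, a)) c =
      if (i : ℕ) + 1 = ν then denPoly hn A B a c else 0 := by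
    rw [hB, Matrix.mul_apply]
    simp only [map_apply, transpose_apply, lastBlock_apply]
    by_cases hi : (i : ℕ) + 1 = ν <;> simp [hi]
  rw [hright, Matrix.sub_apply, Matrix.smul_apply, powerColumn_apply]
  by_cases hi : (i : ℕ) + 1 = ν
  · have hrow : ((AStar hn A B).map Polynomial.C * powerColumn hn) (blockEquiv hn (i, a)) c =
        ((lastBlock hn * AStar hn A B).map Polynomial.C * powerColumn hn) a c := by
      rw [Matrix.mul_apply, Matrix.mul_apply]
      simp only [map_apply, lastBlock_mul hn _ hi]
    rw [if_pos hi, denPoly_eq, hrow, Matrix.sub_apply, Matrix.smul_apply, Matrix.one_apply]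
    congr 1
    split_ifs
    · rw [smul_eq_mul, smul_eq_mul, ← pow_succ', hi, mul_one]
    · simp
  · have hj : (i : ℕ) + 1 < ν := by omega
    have hrow : ((AStar hn A B).map Polynomial.C * powerColumn hn) (blockEquiv hn (i, a)) c =
        powerColumn hn (blockEquiv hn (⟨i + 1, hj⟩, a)) c := by
      rw [Matrix.mul_apply]
      simp only [map_apply, AStar_apply_of_lt hn hN (j := ⟨i + 1, hj⟩) rfl]
      simp [Matrix.one_apply]
    rw [if_neg hi, hrow, powerColumn_apply]
    split_ifs
    · rw [smul_eq_mul, ← pow_succ', sub_self]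
    · simp

/-- The witness is `S = N⁻¹ [I; sI; …; s^{ν-1} I]`: undoing the change of coordinates carries the
identity for `(A*, B*)` over to `(A, B)`, and the first block row of `N` recovers the identity. -/
theorem exists_resolvent_column (hν : 0 < ν) (hN : IsUnit (transformation hn A B).det)
    (hB : BStar hn A B = (lastBlock hn)ᵀ) (C : Matrix (Fin l) (Fin n) ℝ) :
    ∃ (S : Matrix (Fin n) (Fin r) ℝ[X]) (F : Matrix (Fin r) (Fin n) ℝ[X]),
      charmatrix A * S = B.map Polynomial.C * denPoly hn A B ∧ F * S = 1 ∧
        numPoly hn A B C = C.map Polynomial.C * S := by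
  set N := transformation hn A B with hNdef
  have hNN : (N.map Polynomial.C) * (N⁻¹.map Polynomial.C) = 1 := by
    rw [← Matrix.map_mul, mul_nonsing_inv _ hN]
    simp
  refine ⟨N⁻¹.map Polynomial.C * powerColumn hn,
    (N.map Polynomial.C).submatrix (fun a => blockEquiv hn (⟨0, hν⟩, a)) id, ?_, ?_, ?_⟩
  · have h1 : charmatrix A * N⁻¹.map Polynomial.C =
        N⁻¹.map Polynomial.C * charmatrix (AStar hn A B) := by
      rw [charmatrix_eq, charmatrix_eq, Matrix.sub_mul, Matrix.mul_sub, Matrix.smul_mul, Matrix.mul_smul,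
        Matrix.one_mul, Matrix.mul_one, ← Matrix.map_mul, ← Matrix.map_mul, AStar, ← hNdef,
        Matrix.mul_assoc, ← Matrix.mul_assoc, nonsing_inv_mul _ hN, Matrix.one_mul]
    rw [← Matrix.mul_assoc, h1, Matrix.mul_assoc, charmatrix_AStar_mul_powerColumn hn hN hB,
      ← Matrix.mul_assoc, ← Matrix.map_mul, BStar, ← hNdef, ← Matrix.mul_assoc,
      nonsing_inv_mul _ hN, Matrix.one_mul]
  · have h2 : (N.map Polynomial.C).submatrix (fun a => blockEquiv hn (⟨0, hν⟩, a)) id *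
        (N⁻¹.map Polynomial.C * powerColumn hn) =
        (N.map Polynomial.C * (N⁻¹.map Polynomial.C * powerColumn hn)).submatrix
          (fun a => blockEquiv hn (⟨0, hν⟩, a)) id := rfl
    rw [h2, ← Matrix.mul_assoc, hNN, Matrix.one_mul]
    ext1 a c
    rw [submatrix_apply, id, powerColumn_apply, Matrix.one_apply]
    simp
  · rw [numPoly_eq, CStar, ← hNdef, Matrix.map_mul, Matrix.mul_assoc]

end Companion

/-- The resolvent identity `(sI - A) S = B P`, with `S` left invertible, makes `P` nonsingular. -/
theorem det_ne_zero_of_resolvent {n r : ℕ} {A : Matrix (Fin n) (Fin n) ℝ}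
    {B : Matrix (Fin n) (Fin r) ℝ} {S : Matrix (Fin n) (Fin r) ℝ[X]}
    {P : Matrix (Fin r) (Fin r) ℝ[X]} {F : Matrix (Fin r) (Fin n) ℝ[X]}
    (hS : charmatrix A * S = B.map Polynomial.C * P) (hF : F * S = 1) : P.det ≠ 0 := by
  intro h0
  obtain ⟨v, hv, hPv⟩ := exists_mulVec_eq_zero_iff.2 h0
  have h1 : charmatrix A *ᵥ (S *ᵥ v) = 0 := by
    rw [mulVec_mulVec, hS, ← mulVec_mulVec, hPv, mulVec_zero]
  have h2 : S *ᵥ v = 0 := eq_zero_of_mulVec_eq_zero A.charpoly_monic.ne_zero h1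
  refine hv ?_
  rw [← one_mulVec v, ← hF, ← mulVec_mulVec, h2, mulVec_zero]

theorem toRat_charmatrix {n : ℕ} (A : Matrix (Fin n) (Fin n) ℝ) :
    toRat (charmatrix A) =
      (RatFunc.X : RatFunc ℝ) • (1 : Matrix (Fin n) (Fin n) (RatFunc ℝ)) - A.map RatFunc.C := by
  ext i j
  by_cases hij : i = j
  · subst hij
    simp [toRat]
  · simp [toRat, hij]

theorem toRat_map_C {m n : ℕ} (M : Matrix (Fin m) (Fin n) ℝ) :
    toRat (M.map Polynomial.C) = M.map RatFunc.C := by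
  ext i j
  simp [toRat]

theorem transferMatrix_eq_of_resolvent {n r l : ℕ} {A : Matrix (Fin n) (Fin n) ℝ}
    {B : Matrix (Fin n) (Fin r) ℝ} (C : Matrix (Fin l) (Fin n) ℝ)
    {S : Matrix (Fin n) (Fin r) ℝ[X]} {P : Matrix (Fin r) (Fin r) ℝ[X]}
    (hS : charmatrix A * S = B.map Polynomial.C * P) (hP : P.det ≠ 0) :
    transferMatrix A B C = toRat (C.map Polynomial.C * S) * (toRat P)⁻¹ := by
  have hA : IsUnit (toRat (charmatrix A)).det := isUnit_det_toRat A.charpoly_monic.ne_zero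
  have hPu := isUnit_det_toRat hP
  have hB : B.map RatFunc.C = toRat (charmatrix A) * toRat S * (toRat P)⁻¹ := by
    rw [← toRat_mul, hS, toRat_mul, Matrix.mul_assoc, mul_nonsing_inv _ hPu, Matrix.mul_one,
      toRat_map_C]
  rw [transferMatrix, ← toRat_charmatrix, hB, toRat_mul, toRat_map_C]
  simp only [Matrix.mul_assoc]
  rw [← Matrix.mul_assoc (toRat (charmatrix A))⁻¹, nonsing_inv_mul _ hA, Matrix.one_mul]

/-! ### The Bezout identity from observability -/

theorem exists_map_pow_eq_add_mul_charmatrix {n : ℕ} (A : Matrix (Fin n) (Fin n) ℝ) (k : ℕ) :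
    ∃ Q : Matrix (Fin n) (Fin n) ℝ[X],
      (A ^ k).map Polynomial.C = (X : ℝ[X]) ^ k • (1 : Matrix (Fin n) (Fin n) ℝ[X]) +
        Q * charmatrix A := by
  have hcomm : Commute (scalar (Fin n) (X : ℝ[X])) (A.map Polynomial.C) :=
    scalar_commute _ (fun _ => Commute.all _ _) _
  have h := hcomm.geom_sum₂_mul k
  refine ⟨-∑ i ∈ Finset.range k,
    scalar (Fin n) (X : ℝ[X]) ^ i * A.map Polynomial.C ^ (k - 1 - i), ?_⟩
  have h1 : scalar (Fin n) (X : ℝ[X]) - A.map Polynomial.C = charmatrix A := rfl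
  rw [h1] at h
  rw [Matrix.neg_mul, h, ← map_pow, Matrix.map_pow, scalar_apply, smul_one_eq_diagonal]
  abel

/-- Modulo the rows of `sI - A`, the rows of `sᵏ C` agree with those of `C Aᵏ`; by observability
the latter span, which yields a left inverse of the stacked matrix `[C; sI - A]`. -/
theorem Observable.exists_bezout {n r l : ℕ} {A : Matrix (Fin n) (Fin n) ℝ}
    {B : Matrix (Fin n) (Fin r) ℝ} {C : Matrix (Fin l) (Fin n) ℝ} (h : Observable A B C) :
    ∃ (U : Matrix (Fin n) (Fin l) ℝ[X]) (V : Matrix (Fin n) (Fin n) ℝ[X]),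
      U * C.map Polynomial.C + V * charmatrix A = 1 := by
  let O : Matrix (Fin n × Fin l) (Fin n) ℝ := Matrix.of fun p j => (C * A ^ (p.1 : ℕ)) p.2 j
  have hker : LinearMap.ker O.mulVecLin = ⊥ := by
    rw [LinearMap.ker_eq_bot']
    intro v hv
    have hlt : ∀ k : Fin n, (C * A ^ (k : ℕ)) *ᵥ v = 0 := fun k => by
      funext c
      exact congrFun hv (k, c)
    refine h.eq_zero_of_forall_pow fun k => ?_
    rw [pow_eq_sum_coeff_smul A k, Matrix.mul_sum, sum_mulVec]
    exact Finset.sum_eq_zero fun j _ => by rw [Matrix.mul_smul, smul_mulVec, hlt, smul_zero]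
  obtain ⟨g, hg⟩ := LinearMap.exists_leftInverse_of_injective _ hker
  set L := LinearMap.toMatrix' g
  have hL : L * O = 1 := by
    have hO : LinearMap.toMatrix' O.mulVecLin = O := LinearMap.toMatrix'_toLin' O
    rw [← hO, ← LinearMap.toMatrix'_comp, hg, LinearMap.toMatrix'_id]
  let Lb : Fin n → Matrix (Fin n) (Fin l) ℝ := fun k => Matrix.of fun i c => L i (k, c)
  have hsum : ∑ k : Fin n, Lb k * C * A ^ (k : ℕ) = 1 := by
    rw [← hL]
    ext i j
    rw [Matrix.sum_apply, Matrix.mul_apply, Fintype.sum_prod_type]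
    refine Finset.sum_congr rfl fun k _ => ?_
    rw [Matrix.mul_assoc, Matrix.mul_apply]
    rfl
  choose Q hQ using exists_map_pow_eq_add_mul_charmatrix A
  have hmap : ∑ k : Fin n, (Lb k).map Polynomial.C * C.map Polynomial.C *
      (A ^ (k : ℕ)).map Polynomial.C = 1 := by
    have := congrArg (fun M : Matrix (Fin n) (Fin n) ℝ => Polynomial.C.mapMatrix M) hsum
    simpa [map_sum, Matrix.map_mul] using this
  refine ⟨∑ k : Fin n, (X : ℝ[X]) ^ (k : ℕ) • (Lb k).map Polynomial.C,
    ∑ k : Fin n, (Lb k).map Polynomial.C * C.map Polynomial.C * Q k, ?_⟩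
  rw [← hmap, Matrix.sum_mul, Matrix.sum_mul, ← Finset.sum_add_distrib]
  refine Finset.sum_congr rfl fun k _ => ?_
  rw [hQ, Matrix.mul_add, Matrix.mul_smul, Matrix.mul_one, Matrix.smul_mul, ← Matrix.mul_assoc]

end Asseo

end

theorem theorem4p1 {n r l ν : ℕ} (hpos : 0 < n) (hn : n = ν * r)
    (A : Matrix (Fin n) (Fin n) ℝ) (B : Matrix (Fin n) (Fin r) ℝ) (C : Matrix (Fin l) (Fin n) ℝ)
    (hctrb : Asseo.Controllable A B) (hν : Asseo.IsControllabilityIndex A B ν)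
    (hobs : Asseo.Observable A B C) :
    -- the transformation to the block companion form
    IsUnit (Asseo.transformation hn A B).det ∧
    Asseo.AStar hn A B = Asseo.blockCompanion hn (Asseo.AStarTwo hn A B) ∧
    Asseo.BStar hn A B = (Asseo.lastBlock hn)ᵀ ∧
    -- the factorization of the transfer function matrix
    (Asseo.denPoly hn A B).det ≠ 0 ∧
    Asseo.transferMatrix A B C =
      Asseo.toRat (Asseo.numPoly hn A B C) * (Asseo.toRat (Asseo.denPoly hn A B))⁻¹ ∧
    -- relative primeness
    Asseo.RelativelyRightPrime (Asseo.numPoly hn A B C) (Asseo.denPoly hn A B) ∧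
    -- the numerator
    Asseo.IsNumerator (Asseo.transferMatrix A B C) (Asseo.numPoly hn A B C) ∧
    -- the transmission zeros
    Asseo.transmissionZeros (Asseo.transferMatrix A B C) =
      Asseo.invariantZeros (Asseo.numPoly hn A B C) ∧
    -- the square case
    (∀ hlr : l = r, (Asseo.transferMatrix A B C).rank = r →
      ((Asseo.numPoly hn A B C).submatrix (Fin.cast hlr.symm) id).det ≠ 0 ∧
      Asseo.transmissionZeros (Asseo.transferMatrix A B C) =
        ((Asseo.numPoly hn A B C).submatrix (Fin.cast hlr.symm) id).det.aroots ℂ) := by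
  have hν0 : 0 < ν := Nat.pos_of_ne_zero fun h => by simp [hn, h] at hpos
  have hrank : (Asseo.ctrbMatrix A B ν).rank = n := by
    rw [← show (Asseo.ctrbMatrix A B n).rank = (Asseo.ctrbMatrix A B ν).rank from hν.1,
      hctrb.rank_ctrbMatrix]
  have hQ := Asseo.isUnit_det_ctrbSquare hn hrank
  have hN := Asseo.isUnit_det_transformation hn hQ
  have hB := Asseo.BStar_eq_transpose_lastBlock hn hQ
  obtain ⟨S, F, hS, hF, hK⟩ := Asseo.exists_resolvent_column hn hν0 hN hB C
  have hP := Asseo.det_ne_zero_of_resolvent hS hF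
  have hG := Asseo.transferMatrix_eq_of_resolvent C hS hP
  rw [← hK] at hG
  obtain ⟨U, V, hUV⟩ := hobs.exists_bezout
  have hbez : (F * U) * Asseo.numPoly hn A B C +
      (F * V * B.map Polynomial.C) * Asseo.denPoly hn A B = 1 := by
    calc _ = F * ((U * C.map Polynomial.C + V * charmatrix A) * S) := by
          rw [hK, Matrix.mul_assoc (F * V), ← hS, Matrix.add_mul, Matrix.mul_add]
          simp only [Matrix.mul_assoc]
      _ = 1 := by rw [hUV, Matrix.one_mul, hF]
  have hprime := Asseo.relativelyRightPrime_of_bezout hbez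
  refine ⟨hN, Asseo.AStar_eq_blockCompanion hn hN, hB, hP, hG, hprime, ⟨_, hP, hG, hprime⟩,
    Asseo.transmissionZeros_eq_invariantZeros hP hG hbez, ?_⟩
  rintro rfl hfull
  exact Asseo.transmissionZeros_eq_aroots_det hP hG hbez hfull
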